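/- Let $d,s\ge 1$ be integers. For $\alpha\in\mathbb N^d$ write $\|\alpha\|_1=\alpha_1+\dots+\alpha_d$, and let $$C^s_u([0,1]^d)=\bigl\{f\in C^s([0,1]^d):\ \|\partial^{\alpha}f\|_{L^\infty([0,1]^d)}\le 1\ \text{ for all }\alpha\in\mathbb N^d\text{ with }\|\alpha\|_1\le s\bigr\}$$ be the closed unit ball of $C^s([0,1]^d)$, the space of functions all of whose partial derivatives of order at most $s$ exist and are continuous on $[0,1]^d$. A ReLU network with $d$ inputs, one output and $L\ge 1$ hidden layers of widths $N_1,\dots,N_L\ge 1$ computes the function $$\phi=\mathcal L_L\circ\sigma\circ\mathcal L_{L-1}\circ\sigma\circ\cdots\circ\sigma\circ\mathcal L_0:\ \mathbb R^d\to\mathbb R,$$ where $\sigma$ is $t\mapsto\max\{0,t\}$ applied to each coordinate, $\mathcal L_i(y)=A_iy+b_i$ with $A_i\in\mathbb R^{N_{i+1}\times N_i}$ and $b_i\in\mathbb R^{N_{i+1}}$, $N_0=d$ and $N_{L+1}=1$; its number of parameters is the total number $\sum_{i=0}^{L}N_{i+1}(N_i+1)$ of entries of the matrices $A_i$ and the vectors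 $b_i$. Then there are a constant $C>0$ and an integer $W_0$, both depending only on $s$ and $d$, such that for every integer $W\ge W_0$ and every $f\in C^s_u([0,1]^d)$ there is a function $\phi$ computed by a ReLU network with exactly $W$ parameters such that $$\|\phi-f\|_{L^\infty([0,1]^d)}\le C\left(\frac{W}{\ln W}\right)^{-2s/d}.$$ -/

import Mathlib

open MeasureTheory

/-- The closed unit cube `[0,1]^d`. -/
def unitCube (d : ℕ) : Set (Fin d → ℝ) := Set.Icc 0 1

/-- The first-order partial derivative of `g` in the `i`-th variable, relative to `[0,1]^d`
(two-sided inside the cube, one-sided on its faces). -/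
noncomputable def cubePartial {d : ℕ} (i : Fin d) (g : (Fin d → ℝ) → ℝ) : (Fin d → ℝ) → ℝ :=
  fun x => lineDerivWithin ℝ g (unitCube d) x (Pi.single i 1)

/-- The partial derivative `∂^α = ∂₁^{α₁} ∂₂^{α₂} ⋯ ∂_d^{α_d}` of a multi-index `α`,
relative to `[0,1]^d`. -/
noncomputable def cubeMultiPartial {d : ℕ} (α : Fin d → ℕ) (f : (Fin d → ℝ) → ℝ) :
    (Fin d → ℝ) → ℝ :=
  (List.finRange d).foldr (fun i g => (cubePartial i)^[α i] g) f

/-- The norm of `L^∞([0,1]^d)`. -/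
noncomputable def cubeLInftyNorm {d : ℕ} (g : (Fin d → ℝ) → ℝ) : ENNReal :=
  eLpNorm g ⊤ (volume.restrict (unitCube d))

/-- The closed unit ball of `C^s([0,1]^d)`: functions that are `s` times continuously
differentiable on the closed cube, with `‖∂^α f‖_{L^∞([0,1]^d)} ≤ 1` for all multi-indices `α`
with `α₁ + ⋯ + α_d ≤ s`. -/
def CsUnitBall (d s : ℕ) : Set ((Fin d → ℝ) → ℝ) :=
  {f | ContDiffOn ℝ s f (unitCube d) ∧
    ∀ α : Fin d → ℕ, ∑ i, α i ≤ s → cubeLInftyNorm (cubeMultiPartial α f) ≤ 1}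

/-- The rectified linear unit `x ↦ max 0 x`, applied to each coordinate. -/
noncomputable def reluVec {n : ℕ} (x : Fin n → ℝ) : Fin n → ℝ := fun i => max 0 (x i)

/-- Fully connected feed-forward networks with `n` inputs, `m` outputs, and hidden layers whose
widths are listed in the second argument: a weight matrix and a bias vector for each affine map. -/
inductive ReLUNet : ℕ → List ℕ → ℕ → Type
  | output {n m : ℕ} (A : Matrix (Fin m) (Fin n) ℝ) (b : Fin m → ℝ) : ReLUNet n [] m
  | layer {n k m : ℕ} {ws : List ℕ} (A : Matrix (Fin k) (Fin n) ℝ) (b : Fin k → ℝ)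
      (rest : ReLUNet k ws m) : ReLUNet n (k :: ws) m

/-- The function computed by a network: ReLU is applied after each affine map but the last. -/
noncomputable def ReLUNet.eval : {n m : ℕ} → {ws : List ℕ} → ReLUNet n ws m →
    (Fin n → ℝ) → (Fin m → ℝ)
  | _, _, _, .output A b, x => A.mulVec x + b
  | _, _, _, .layer A b rest, x => rest.eval (reluVec (A.mulVec x + b))

/-- The total number of parameters (entries of all weight matrices and bias vectors) of the
architecture with `n` inputs, hidden widths `ws` and `m` outputs. -/
def numParameters (n : ℕ) : List ℕ → ℕ → ℕ
  | [], m => m * n + m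
  | k :: ws, m => (k * n + k) + numParameters k ws m

/-- The functions `ℝ^d → ℝ` implemented by a ReLU network (with at least one hidden layer, and
nonempty hidden layers) that has `W` parameters. -/
def NNParam (d W : ℕ) : Set ((Fin d → ℝ) → ℝ) :=
  {φ | ∃ ws : List ℕ, ws ≠ [] ∧ (∀ k ∈ ws, 0 < k) ∧ numParameters d ws 1 = W ∧
    ∃ net : ReLUNet d ws 1, ∀ x, φ x = net.eval x 0}

/-! The cube is cut into `k ^ (2 * d)` cells of side `1 / k ^ 2`, and on each cell `f` is replaced
by its Taylor polynomial at the lower corner, with error of order `k ^ (-2 * s)` (`exists_taylor`).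
The network must reproduce these polynomials with only about `k ^ d * log k` parameters, the square
root of the number of cells up to the logarithm. It has bounded width, so parameters are counted by
depth.

The saving comes from bit extraction. In each coordinate the cell index is written as two digits in
base `k`; the coarse digits together form a row number `A < k ^ d`, the fine ones a column number `P
< k ^ d` (`exists_coord`, `sum_digits_decode`). Weights are arbitrary reals, so a single one can
store a whole row of `k ^ d` bits. Selecting the row takes `O(k ^ d)` layers, and so does peeling
its bits off one by one until column `P` is reached (`exists_lookup`, `exists_extract`,
`exists_bit`). Each Taylor coefficient needs `O(log k)` bits for accuracy `k ^ (-2 * s)`, which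
gives depth `O(k ^ d * log k)` in total (`exists_term`). Monomials and products cost only `O(log k)`
layers, since the tent map yields squares with exponentially small error (`exists_mul`,
`exists_word`). `exists_computes_approx` puts these together.

Digits are discontinuous, so a ReLU network gets them right only off thin gaps to the left of the
grid points. Among three arguments shifted by `-δ`, `0`, `δ` at most one lies in a gap, so the
median of the three outputs is correct; doing this in one coordinate after another removes all gaps
(`ApproxOffGaps.succ`, `ApproxOffGaps.all`). The width `δ` may depend on `f`, because it affects the
sizes of weights but not their number.

Networks are handled through `Computes`, a calculus of registers holding nonnegative functions,
which ReLU copies unchanged. `Computes.exists_net` turns a computation into a network, padded to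
exactly `W` parameters, and `exists_size` chooses `k` from `W`. -/

/-! ### Register computations and their realisation by networks. -/

/-- Affine combinations of the functions in a list. -/
inductive IsAff {X : Type} (l : List (X → ℝ)) : (X → ℝ) → Prop
  | const (c : ℝ) : IsAff l (fun _ => c)
  | mem {g : X → ℝ} : g ∈ l → IsAff l g
  | add {f g : X → ℝ} : IsAff l f → IsAff l g → IsAff l (fun x => f x + g x)
  | smul {f : X → ℝ} (c : ℝ) : IsAff l f → IsAff l (fun x => c * f x)

namespace IsAff

variable {X : Type} {l l' : List (X → ℝ)} {f g : X → ℝ}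

theorem sub (hf : IsAff l f) (hg : IsAff l g) : IsAff l (fun x => f x - g x) := by
  have := hf.add (hg.smul (-1))
  convert this using 2
  ring

theorem mono (h : l ⊆ l') (hf : IsAff l f) : IsAff l' f := by
  induction hf with
  | const c => exact .const c
  | mem hg => exact .mem (h hg)
  | add _ _ h1 h2 => exact h1.add h2
  | smul c _ h1 => exact h1.smul c

theorem sum {ι : Type} (s : Finset ι) {F : ι → X → ℝ} (hF : ∀ i ∈ s, IsAff l (F i)) :
    IsAff l (fun x => ∑ i ∈ s, F i x) := by
  classical
  induction s using Finset.induction_on with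
  | empty => simpa using IsAff.const (l := l) 0
  | insert a s ha ih =>
    simp only [Finset.sum_insert ha]
    exact (hF a (by simp)).add (ih fun i hi => hF i (by simp [hi]))

/-- Produces one row of a weight matrix and its bias. The family `u` may contain more functions than
`l`; the others get weight zero. -/
theorem exists_row {n : ℕ} {u : Fin n → X → ℝ} (hu : ∀ g ∈ l, ∃ i, u i = g) (hf : IsAff l f) :
    ∃ (a : Fin n → ℝ) (b : ℝ), ∀ x, f x = ∑ i, a i * u i x + b := by
  induction hf with
  | const c => exact ⟨0, c, by simp⟩
  | mem hg =>
    obtain ⟨i, rfl⟩ := hu _ hg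
    exact ⟨Pi.single i 1, 0, by simp [Pi.single_apply]⟩
  | add _ _ h1 h2 =>
    obtain ⟨a, b, h⟩ := h1
    obtain ⟨a', b', h'⟩ := h2
    refine ⟨a + a', b + b', fun x => ?_⟩
    simp only [h, h', Pi.add_apply, add_mul, Finset.sum_add_distrib]
    ring
  | smul c _ h1 =>
    obtain ⟨a, b, h⟩ := h1
    refine ⟨c • a, c * b, fun x => ?_⟩
    simp only [h, Pi.smul_apply, smul_eq_mul, mul_add, Finset.mul_sum, mul_assoc]

end IsAff

/-- `Computes B T l l'`: from registers holding the functions in `l`, at most `T` layers of width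
at most `B` lead to registers holding (at least) the functions in `l'`. -/
inductive Computes {X : Type} (B : ℕ) : ℕ → List (X → ℝ) → List (X → ℝ) → Prop
  | done {T : ℕ} {l l' : List (X → ℝ)} : l' ⊆ l → Computes B T l l'
  | step {T : ℕ} {l l₁ l' : List (X → ℝ)} : l₁ ≠ [] → l₁.length ≤ B →
      (∀ g ∈ l₁, ∃ f, IsAff l f ∧ g = fun x => max 0 (f x)) → Computes B T l₁ l' →
      Computes B (T + 1) l l'

/-- All functions in the list are nonnegative. -/
def AllNonneg {X : Type} (l : List (X → ℝ)) : Prop := ∀ g ∈ l, ∀ x, 0 ≤ g x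

namespace AllNonneg

variable {X : Type} {l l' : List (X → ℝ)} {f : X → ℝ}

theorem nil : AllNonneg ([] : List (X → ℝ)) := by simp [AllNonneg]

theorem cons (hf : ∀ x, 0 ≤ f x) (hl : AllNonneg l) : AllNonneg (f :: l) := by
  intro g hg
  rcases List.mem_cons.1 hg with rfl | hg
  · exact hf
  · exact hl g hg

theorem subset (hl : AllNonneg l) (h : l' ⊆ l) : AllNonneg l' := fun g hg => hl g (h hg)

end AllNonneg

namespace Computes

variable {X : Type} {B B' T T' : ℕ} {l l₁ l₂ l' R : List (X → ℝ)} {f g h : X → ℝ}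

theorem mono (hc : Computes B T l l') (hB : B ≤ B') (hT : T ≤ T') : Computes B' T' l l' := by
  induction hc generalizing T' with
  | done h => exact .done h
  | step h1 h2 h3 _ ih =>
    obtain ⟨T', rfl⟩ : ∃ t, T' = t + 1 := ⟨T' - 1, by omega⟩
    exact .step h1 (h2.trans hB) h3 (ih (by omega))

theorem of_subset (hc : Computes B T l l') (hl : l ⊆ l₁) : Computes B T l₁ l' := by
  cases hc with
  | done h => exact .done fun _ hg => hl (h hg)
  | step h1 h2 h3 h4 =>
    refine .step h1 h2 (fun g hg => ?_) h4
    obtain ⟨f, hf, e⟩ := h3 g hg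
    exact ⟨f, hf.mono hl, e⟩

theorem trans (h₁ : Computes B T l l₁) (h₂ : Computes B T' l₁ l') :
    Computes B (T + T') l l' := by
  induction h₁ with
  | done h => exact (h₂.of_subset h).mono le_rfl (by omega)
  | step h1 h2 h3 _ ih =>
    have := Computes.step h1 h2 h3 (ih h₂)
    exact this.mono le_rfl (by omega)

/-- ReLU fixes nonnegative values, so the registers in `R` can be carried through every layer by
identity rows, at the price of `R.length` in width and nothing in depth. -/
theorem frame (hc : Computes B T l l') (hR : AllNonneg R) :
    Computes (B + R.length) T (l ++ R) (l' ++ R) := by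
  induction hc with
  | done h =>
    refine .done fun g hg => ?_
    rcases List.mem_append.1 hg with hg | hg
    · exact List.mem_append_left _ (h hg)
    · exact List.mem_append_right _ hg
  | step h1 h2 h3 _ ih =>
    refine .step (by simp [h1]) (by simp; omega) (fun g hg => ?_) ih
    rcases List.mem_append.1 hg with hg | hg
    · obtain ⟨f, hf, e⟩ := h3 g hg
      exact ⟨f, hf.mono (List.subset_append_left _ _), e⟩
    · refine ⟨g, .mem (List.mem_append_right _ hg), ?_⟩
      funext x
      exact (max_eq_right (hR g hg x)).symm

/-- Run a subroutine, keeping all registers. -/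
theorem call (hc : Computes B T l₁ [h]) (hl : AllNonneg l) (hs : l₁ ⊆ l) (hB : B + l.length ≤ B')
    (hr : Computes B' T' (h :: l) l') : Computes B' (T + T') l l' := by
  have := (hc.frame hl).of_subset (l₁ := l) (by simp [hs])
  exact (this.mono hB le_rfl).trans hr

theorem push_relu (f : X → ℝ) (hl : AllNonneg l) (hf : IsAff l f) (hB : l.length + 1 ≤ B)
    (hr : Computes B T ((fun x => max 0 (f x)) :: l) l') : Computes B (T + 1) l l' := by
  refine .step (by simp) (by simpa using hB) (fun g hg => ?_) hr
  rcases List.mem_cons.1 hg with rfl | hg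
  · exact ⟨f, hf, rfl⟩
  · exact ⟨g, .mem hg, funext fun x => (max_eq_right (hl g hg x)).symm⟩

theorem push (f : X → ℝ) (hf0 : ∀ x, 0 ≤ f x) (hl : AllNonneg l) (hf : IsAff l f)
    (hB : l.length + 1 ≤ B) (hr : Computes B T (f :: l) l') : Computes B (T + 1) l l' := by
  refine push_relu f hl hf hB ?_
  have : (fun x => max 0 (f x)) = f := funext fun x => max_eq_right (hf0 x)
  rwa [this]

/-- Accumulate a sum of subroutine results. -/
theorem sum_range {n : ℕ} {F : ℕ → X → ℝ} (hl : AllNonneg l) (hF0 : ∀ i < n, ∀ x, 0 ≤ F i x)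
    (hF : ∀ i < n, Computes B T l [F i]) :
    Computes (B + l.length + 3) (n * (T + 1) + 1) l [fun x => ∑ i ∈ Finset.range n, F i x] := by
  -- The inputs `l` are kept next to the partial sum because the next summand reads them again;
  -- summands run one after another, so their number affects depth only.
  suffices H : Computes (B + l.length + 3) (n * (T + 1) + 1) l
      ((fun x => ∑ i ∈ Finset.range n, F i x) :: l) from
    (H.trans (T' := 0) (.done (by simp))).mono le_rfl (by omega)
  induction n with
  | zero =>
    refine (push (T := 0) (fun _ => (0 : ℝ)) (by simp) hl (.const 0) (by omega)
      (.done (by simp))).mono le_rfl (by omega)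
  | succ n ih =>
    have h1 := ih (fun i hi => hF0 i (by omega)) (fun i hi => hF i (by omega))
    set S : X → ℝ := fun x => ∑ i ∈ Finset.range n, F i x with hS
    have hS0 : ∀ x, 0 ≤ S x := fun x =>
      Finset.sum_nonneg fun i hi => hF0 i (by have := Finset.mem_range.1 hi; omega) x
    have h2 : Computes (B + l.length + 3) (T + 1) (S :: l)
        ((fun x => ∑ i ∈ Finset.range (n + 1), F i x) :: l) := by
      refine call (hF n (by omega)) (hl.cons hS0) (by simp) (by simp; omega) ?_
      refine push (T := 0) (fun x => S x + F n x) (fun x => add_nonneg (hS0 x) (hF0 n (by omega) x))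
        ((hl.cons hS0).cons (hF0 n (by omega))) (.add (.mem (by simp)) (.mem (by simp)))
        (by simp) (.done ?_)
      simp only [Finset.sum_range_succ]
      intro g hg
      rcases List.mem_cons.1 hg with rfl | hg
      · simp [hS]
      · simp [hg]
    exact (h1.trans h2).mono le_rfl (by nlinarith)

/-- A layer between widths at most `B` has at most `B * B + B` parameters; what is left of `W` is
spent on layers that copy `h`. The output layer is not followed by ReLU, so its bias can subtract
the `r` that kept `h` nonnegative. -/
theorem exists_net {B T : ℕ} {l : List (X → ℝ)} (hc : Computes B T l [h]) (hB : 1 ≤ B) (r : ℝ) {n : ℕ} (hn : n ≤ B)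
    (u : Fin n → X → ℝ) (hu : ∀ g ∈ l, ∃ i, u i = g) (hh : ∀ x, 0 ≤ h x) (W : ℕ)
    (hW : (T + 1) * (B * B + B) + 9 ≤ W) :
    ∃ ws : List ℕ, ws ≠ [] ∧ (∀ k ∈ ws, 0 < k) ∧ numParameters n ws 1 = W ∧
      ∃ net : ReLUNet n ws 1, ∀ x, net.eval (fun i => u i x) 0 = h x - r := by
  -- An identity layer of width one adds two parameters, which reaches every even count.
  have hpad : ∀ j : ℕ, ∃ ws : List ℕ, (∀ k ∈ ws, 0 < k) ∧ numParameters 1 ws 1 = 2 * j + 2 ∧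
      ∃ net : ReLUNet 1 ws 1, ∀ t : ℝ, 0 ≤ t → net.eval (fun _ => t) 0 = t - r := by
    intro j
    induction j with
    | zero =>
      refine ⟨[], by simp, by simp [numParameters], .output (fun _ _ => 1) (fun _ => -r), ?_⟩
      intro t _
      simp [ReLUNet.eval, Matrix.mulVec, dotProduct, sub_eq_add_neg]
    | succ j ih =>
      obtain ⟨ws, h1, h2, net, h3⟩ := ih
      refine ⟨1 :: ws, by simpa using h1, by simp [numParameters, h2]; ring,
        .layer (fun _ _ => 1) 0 net, fun t ht => ?_⟩
      rw [← h3 t ht]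
      simp only [ReLUNet.eval]
      congr 2
      funext i
      simp [reluVec, Matrix.mulVec, dotProduct, ht]
  -- A layer of width two followed by one of width one adds `4 + 3 = 7` parameters and switches
  -- parity.
  have hpad' : ∀ j : ℕ, ∃ ws : List ℕ, (∀ k ∈ ws, 0 < k) ∧ numParameters 1 ws 1 = 2 * j + 9 ∧
      ∃ net : ReLUNet 1 ws 1, ∀ t : ℝ, 0 ≤ t → net.eval (fun _ => t) 0 = t - r := by
    intro j
    obtain ⟨ws, h1, h2, net, h3⟩ := hpad j
    refine ⟨2 :: 1 :: ws, by simpa using h1, by simp [numParameters, h2]; ring,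
      .layer (fun _ _ => 1) 0 (.layer (fun _ i => if i = 0 then 1 else 0) 0 net), fun t ht => ?_⟩
    rw [← h3 t ht]
    simp only [ReLUNet.eval]
    congr 2
    funext i
    simp [reluVec, Matrix.mulVec, dotProduct, ht]
  have hpadW : ∀ V : ℕ, 8 ≤ V → ∃ ws : List ℕ, (∀ k ∈ ws, 0 < k) ∧ numParameters 1 ws 1 = V ∧
      ∃ net : ReLUNet 1 ws 1, ∀ t : ℝ, 0 ≤ t → net.eval (fun _ => t) 0 = t - r := by
    intro V hV
    rcases Nat.even_or_odd' V with ⟨j, rfl | rfl⟩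
    · obtain ⟨j, rfl⟩ : ∃ i, j = i + 1 := ⟨j - 1, by omega⟩
      exact hpad j
    · obtain ⟨j, rfl⟩ : ∃ i, j = i + 4 := ⟨j - 4, by omega⟩
      exact hpad' j
  induction T generalizing l n W with
  | zero =>
    cases hc with
    | done hs =>
      obtain ⟨i, hi⟩ := hu h (hs (by simp))
      have : n + 1 ≤ B * B + B := by nlinarith
      obtain ⟨ws, h1, h2, net, h3⟩ := hpadW (W - (n + 1)) (by omega)
      -- This layer selects the register `h` and also ensures that there is a hidden layer even if
      -- the computation is empty.
      refine ⟨1 :: ws, by simp, by simpa using h1, by simp [numParameters, h2]; omega,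
        .layer (fun _ j => if j = i then 1 else 0) 0 net, fun x => ?_⟩
      rw [← h3 (h x) (hh x)]
      simp only [ReLUNet.eval]
      congr 2
      funext j
      simp [reluVec, Matrix.mulVec, dotProduct, hi, hh x]
  | succ T ih =>
    cases hc with
    | done hs => exact ih (l := l) (.done hs) hn u hu W (by nlinarith)
    | @step _ _ l₁ _ h1 h2 h3 h4 =>
      have h5 : l₁.length * n + l₁.length ≤ B * B + B :=
        add_le_add (Nat.mul_le_mul h2 hn) h2
      have h6 : (T + 1) * (B * B + B) + 9 ≤ W - (l₁.length * n + l₁.length) := by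
        have : (T + 1 + 1) * (B * B + B) = (T + 1) * (B * B + B) + (B * B + B) := by ring
        omega
      obtain ⟨ws, e1, e2, e3, net, e4⟩ := ih h4 h2 (fun i => l₁.get i)
        (fun g hg => List.mem_iff_get.1 hg) _ h6
      have h7 : ∀ j : Fin l₁.length, ∃ (a : Fin n → ℝ) (b : ℝ),
          ∀ x, l₁.get j x = max 0 (∑ i, a i * u i x + b) := by
        intro j
        obtain ⟨f, hf, e⟩ := h3 (l₁.get j) (List.get_mem _ _)
        obtain ⟨a, b, hab⟩ := hf.exists_row hu
        exact ⟨a, b, fun x => by simp only [e, hab]⟩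
      choose a b hab using h7
      refine ⟨l₁.length :: ws, by simp, ?_, ?_, .layer a b net, fun x => ?_⟩
      · simpa using ⟨List.length_pos_iff.2 h1, e2⟩
      · simp only [numParameters, e3]
        omega
      · rw [← e4 x]
        simp only [ReLUNet.eval]
        congr 2
        funext j
        rw [hab]
        simp [reluVec, Matrix.mulVec, dotProduct]

end Computes

theorem AllNonneg.singleton {X : Type} {f : X → ℝ} (hf : ∀ x, 0 ≤ f x) : AllNonneg [f] :=
  .cons hf .nil

theorem AllNonneg.pair {X : Type} {f g : X → ℝ} (hf : ∀ x, 0 ≤ f x) (hg : ∀ x, 0 ≤ g x) :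
    AllNonneg [f, g] :=
  .cons hf (.singleton hg)

/-! ### Truncation, hat functions and the median as ReLU circuits. -/

/-- Truncation to `[0,1]`, written with ReLUs. -/
noncomputable def clamp01 (t : ℝ) : ℝ := max 0 t - max 0 (t - 1)

theorem clamp01_nonneg (t : ℝ) : 0 ≤ clamp01 t :=
  sub_nonneg.2 (max_le_max le_rfl (by linarith))

theorem clamp01_le_one (t : ℝ) : clamp01 t ≤ 1 := by
  unfold clamp01
  rcases max_cases 0 t with ⟨h, _⟩ | ⟨h, _⟩ <;> rcases max_cases 0 (t - 1) with ⟨h', _⟩ | ⟨h', _⟩ <;>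
    rw [h, h'] <;> linarith

theorem clamp01_of_nonpos {t : ℝ} (h : t ≤ 0) : clamp01 t = 0 := by
  unfold clamp01
  rw [max_eq_left h, max_eq_left (by linarith)]
  ring

theorem clamp01_of_one_le {t : ℝ} (h : 1 ≤ t) : clamp01 t = 1 := by
  unfold clamp01
  rw [max_eq_right (by linarith), max_eq_right (by linarith)]
  ring

theorem clamp01_of_mem {t : ℝ} (h0 : 0 ≤ t) (h1 : t ≤ 1) : clamp01 t = t := by
  unfold clamp01
  rw [max_eq_right h0, max_eq_left (by linarith)]
  ring

theorem abs_clamp01_sub_le {t v : ℝ} (h0 : 0 ≤ v) (h1 : v ≤ 1) : |clamp01 t - v| ≤ |t - v| := by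
  rcases le_total t 0 with h | h
  · rw [clamp01_of_nonpos h, abs_of_nonpos (by linarith), abs_of_nonpos (by linarith)]
    linarith
  rcases le_total 1 t with h' | h'
  · rw [clamp01_of_one_le h', abs_of_nonneg (by linarith), abs_of_nonneg (by linarith)]
    linarith
  · rw [clamp01_of_mem h h']

/-- The hat function of width one around `c`. -/
noncomputable def hat (c t : ℝ) : ℝ := max 0 (1 - max 0 (t - c) - max 0 (c - t))

theorem hat_nonneg (c t : ℝ) : 0 ≤ hat c t := le_max_left _ _

theorem hat_natCast (a b : ℕ) : hat (a : ℝ) (b : ℝ) = if a = b then 1 else 0 := by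
  unfold hat
  rcases lt_trichotomy a b with h | h | h
  · have : (a : ℝ) + 1 ≤ b := by exact_mod_cast h
    rw [if_neg h.ne, max_eq_right (a := 0) (b := (b : ℝ) - a) (by linarith),
      max_eq_left (a := 0) (b := (a : ℝ) - b) (by linarith), max_eq_left (by linarith)]
  · simp [h]
  · have : (b : ℝ) + 1 ≤ a := by exact_mod_cast h
    rw [if_neg h.ne', max_eq_left (a := 0) (b := (b : ℝ) - a) (by linarith),
      max_eq_right (a := 0) (b := (a : ℝ) - b) (by linarith), max_eq_left (by linarith)]

/-- The middle one of three numbers. -/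
noncomputable def median3 (a b c : ℝ) : ℝ := max (min a b) (min (max a b) c)

/-- The median lies between any two of its arguments, so two good values suffice and the third may
be arbitrary. -/
theorem abs_median3_sub_le {a b c v ε : ℝ}
    (h : (|a - v| ≤ ε ∧ |b - v| ≤ ε) ∨ (|a - v| ≤ ε ∧ |c - v| ≤ ε) ∨ (|b - v| ≤ ε ∧ |c - v| ≤ ε)) :
    |median3 a b c - v| ≤ ε := by
  simp only [abs_le] at h ⊢
  unfold median3
  rcases le_total a b with h1 | h1 <;> rcases le_total a c with h2 | h2 <;>
    rcases le_total b c with h3 | h3 <;> simp only [h1, h2, h3, max_eq_left, max_eq_right,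
      min_eq_left, min_eq_right] <;> rcases h with h | h | h <;> constructor <;> linarith

namespace Computes

variable {X : Type} {l : List (X → ℝ)} {f g : X → ℝ}

theorem clamp (hl : AllNonneg l) (hf : IsAff l f) :
    Computes (l.length + 3) 3 l [fun x => clamp01 (f x)] := by
  have h1 : AllNonneg ((fun x => max 0 (f x)) :: l) := hl.cons fun _ => le_max_left _ _
  have h2 : AllNonneg ((fun x => max 0 (f x - 1)) :: (fun x => max 0 (f x)) :: l) :=
    h1.cons fun _ => le_max_left _ _
  refine push_relu f hl hf (by omega) ?_
  refine push_relu (fun x => f x - 1) h1 ((hf.mono (by simp)).sub (.const 1)) (by simp) ?_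
  exact push (T := 0) (fun x => clamp01 (f x)) (fun x => clamp01_nonneg _) h2
    (.sub (.mem (by simp)) (.mem (by simp))) (by simp) (.done (by simp))

theorem hat (hl : AllNonneg l) (hf : IsAff l f) (c : ℝ) :
    Computes (l.length + 3) 3 l [fun x => hat c (f x)] := by
  have h1 : AllNonneg ((fun x => max 0 (f x - c)) :: l) := hl.cons fun _ => le_max_left _ _
  have h2 : AllNonneg ((fun x => max 0 (c - f x)) :: (fun x => max 0 (f x - c)) :: l) :=
    h1.cons fun _ => le_max_left _ _
  refine push_relu (fun x => f x - c) hl (hf.sub (.const c)) (by omega) ?_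
  refine push_relu (fun x => c - f x) h1 (.sub (.const c) (hf.mono (by simp))) (by simp) ?_
  exact push_relu (T := 0) (fun x => 1 - max 0 (f x - c) - max 0 (c - f x)) h2
    (.sub (.sub (.const 1) (.mem (by simp))) (.mem (by simp))) (by simp) (.done (by simp [_root_.hat]))

theorem median {a b c : X → ℝ} (ha : ∀ x, 0 ≤ a x) (hb : ∀ x, 0 ≤ b x) (hc : ∀ x, 0 ≤ c x) :
    Computes 7 4 [a, b, c] [fun x => median3 (a x) (b x) (c x)] := by
  have h0 : AllNonneg [a, b, c] := .cons ha (.pair hb hc)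
  set p : X → ℝ := fun x => max 0 (a x - b x) with hp
  have h1 : AllNonneg [p, a, b, c] := h0.cons fun _ => le_max_left _ _
  set q : X → ℝ := fun x => max 0 (b x + p x - c x) with hq
  have h2 : AllNonneg [q, p, a, b, c] := h1.cons fun _ => le_max_left _ _
  set w : X → ℝ := fun x => max 0 ((b x + p x - q x) - (a x - p x)) with hw
  have h3 : AllNonneg [w, q, p, a, b, c] := h2.cons fun _ => le_max_left _ _
  -- Each minimum or maximum costs one ReLU: `min a b = a - p`, `max a b = b + p`, `min (max a b) c
  -- = b + p - q`, and `w` is the positive part in the outer maximum.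
  have key : (fun x => median3 (a x) (b x) (c x)) = fun x => a x - p x + w x := by
    funext x
    have e1 : min (a x) (b x) = a x - p x := by
      simp only [hp]
      rcases le_total (a x) (b x) with h | h
      · rw [min_eq_left h, max_eq_left (by linarith)]; ring
      · rw [min_eq_right h, max_eq_right (by linarith)]; ring
    have e2 : max (a x) (b x) = b x + p x := by
      simp only [hp]
      rcases le_total (a x) (b x) with h | h
      · rw [max_eq_right h, max_eq_left (by linarith)]; ring
      · rw [max_eq_left h, max_eq_right (by linarith)]; ring
    have e3 : min (b x + p x) (c x) = b x + p x - q x := by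
      simp only [hq]
      rcases le_total (b x + p x) (c x) with h | h
      · rw [min_eq_left h, max_eq_left (by linarith)]; ring
      · rw [min_eq_right h, max_eq_right (by linarith)]; ring
    simp only [median3, e1, e2, e3, hw]
    rcases le_total (a x - p x) (b x + p x - q x) with h | h
    · rw [max_eq_right h, max_eq_right (by linarith)]; ring
    · rw [max_eq_left h, max_eq_left (by linarith)]; ring
  refine push_relu (fun x => a x - b x) h0 (.sub (.mem (by simp)) (.mem (by simp))) (by simp) ?_
  change Computes 7 3 [p, a, b, c] _
  refine push_relu (fun x => b x + p x - c x) h1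
    (.sub (.add (.mem (by simp)) (.mem (by simp))) (.mem (by simp))) (by simp) ?_
  change Computes 7 2 [q, p, a, b, c] _
  refine push_relu (fun x => (b x + p x - q x) - (a x - p x)) h2
    (.sub (.sub (.add (.mem (by simp)) (.mem (by simp))) (.mem (by simp)))
      (.sub (.mem (by simp)) (.mem (by simp)))) (by simp) ?_
  change Computes 7 1 [w, q, p, a, b, c] _
  rw [key]
  refine push (T := 0) (fun x => a x - p x + w x) (fun x => ?_) h3
    (.add (.sub (.mem (by simp)) (.mem (by simp))) (.mem (by simp))) (by simp) (.done (by simp))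
  rw [← congrFun key x]
  exact le_max_of_le_left (le_min (ha x) (hb x))

/-! ### Approximate multiplication. -/

/-- Add `r * t * (1 - t)` to a register, up to an exponentially small error. -/
theorem exists_add_mul_one_sub (m : ℕ) : ∀ (t acc : X → ℝ) (r : ℝ), (∀ x, 0 ≤ t x) →
    (∀ x, t x ≤ 1) → (∀ x, 0 ≤ acc x) → 0 ≤ r → ∃ h : X → ℝ, (∀ x, 0 ≤ h x) ∧
      Computes 5 (3 * m) [t, acc] [h] ∧
      ∀ x, |h x - (acc x + r * (t x * (1 - t x)))| ≤ r / 4 ^ m := by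
  induction m with
  | zero =>
    intro t acc r h0 h1 ha hr
    refine ⟨acc, ha, .done (by simp), fun x => ?_⟩
    have h3 : t x * (1 - t x) ≤ 1 := by nlinarith [h0 x, h1 x]
    have h4 : 0 ≤ t x * (1 - t x) := mul_nonneg (h0 x) (by linarith [h1 x])
    rw [abs_le]
    constructor <;> norm_num <;> nlinarith
  | succ m ih =>
    intro t acc r h0 h1 ha hr
    set p : X → ℝ := fun x => max 0 (t x - 1 / 2) with hp
    set g : X → ℝ := fun x => 2 * t x - 4 * p x with hg
    -- The tent map `g` reproduces `t * (1 - t)` at a quarter of the scale; stopping after `m`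
    -- iterations therefore leaves an error of at most `r / 4 ^ m`.
    have hg1 : ∀ x, 0 ≤ g x ∧ g x ≤ 1 ∧ t x * (1 - t x) = (g x + g x * (1 - g x)) / 4 := by
      intro x
      simp only [hg, hp]
      rcases le_total (t x) (1 / 2) with h | h
      · rw [max_eq_left (by linarith)]
        refine ⟨?_, ?_, by ring⟩ <;> linarith [h0 x]
      · rw [max_eq_right (by linarith)]
        refine ⟨?_, ?_, by ring⟩ <;> linarith [h1 x]
    set acc' : X → ℝ := fun x => acc x + r / 4 * g x with hacc'
    have ha' : ∀ x, 0 ≤ acc' x := fun x =>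
      add_nonneg (ha x) (mul_nonneg (by linarith) (hg1 x).1)
    obtain ⟨h, e1, e2, e3⟩ := ih g acc' (r / 4) (fun x => (hg1 x).1) (fun x => (hg1 x).2.1)
      ha' (by linarith)
    refine ⟨h, e1, ?_, fun x => ?_⟩
    · have n0 : AllNonneg [t, acc] := .pair h0 ha
      have n1 : AllNonneg [p, t, acc] := n0.cons fun _ => le_max_left _ _
      have n2 : AllNonneg [g, p, t, acc] := n1.cons fun x => (hg1 x).1
      have : 3 * (m + 1) = 3 * m + 1 + 1 + 1 := by ring
      rw [this]
      refine push_relu (fun x => t x - 1 / 2) n0 (.sub (.mem (by simp)) (.const _)) (by simp) ?_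
      refine push g (fun x => (hg1 x).1) n1
        (.sub (.smul _ (.mem (by simp))) (.smul _ (.mem (by simp [hp])))) (by simp) ?_
      refine push acc' ha' n2 (.add (.mem (by simp)) (.smul _ (.mem (by simp [hg])))) (by simp) ?_
      exact e2.of_subset (by simp)
    · have := e3 x
      rw [(hg1 x).2.2, pow_succ, mul_comm ((4 : ℝ) ^ m), ← div_div]
      convert this using 3
      simp only [hacc']
      ring

/-- Approximate multiplication on `[0,1]`. -/
theorem exists_mul (m : ℕ) {u v : X → ℝ} (u0 : ∀ x, 0 ≤ u x) (u1 : ∀ x, u x ≤ 1)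
    (v0 : ∀ x, 0 ≤ v x) (v1 : ∀ x, v x ≤ 1) : ∃ h : X → ℝ, (∀ x, 0 ≤ h x) ∧ (∀ x, h x ≤ 1) ∧
      Computes 11 (9 * m + 6) [u, v] [h] ∧ ∀ x, |h x - u x * v x| ≤ 3 / 4 ^ m := by
  set w : X → ℝ := fun x => 1 / 2 * u x + 1 / 2 * v x with hw
  have w0 : ∀ x, 0 ≤ w x := fun x => by simp only [hw]; linarith [u0 x, v0 x]
  have w1 : ∀ x, w x ≤ 1 := fun x => by simp only [hw]; linarith [u1 x, v1 x]
  obtain ⟨a, a0, ca, ea⟩ := exists_add_mul_one_sub m u w (1 / 2) u0 u1 w0 (by norm_num)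
  obtain ⟨b, b0, cb, eb⟩ := exists_add_mul_one_sub m v a (1 / 2) v0 v1 a0 (by norm_num)
  set z : X → ℝ := fun _ => 0 with hz
  have z0 : ∀ x, 0 ≤ z x := fun _ => le_rfl
  obtain ⟨c, c0, cc, ec⟩ := exists_add_mul_one_sub m w z 2 w0 w1 z0 (by norm_num)
  refine ⟨fun x => clamp01 (b x - c x), fun x => clamp01_nonneg _, fun x => clamp01_le_one _,
    ?_, fun x => ?_⟩
  · have n0 : AllNonneg [u, v] := .pair u0 v0
    have n1 : AllNonneg [w, u, v] := n0.cons w0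
    have n2 : AllNonneg [z, w, u, v] := n1.cons z0
    have : 9 * m + 6 = 3 * m + (3 * m + (3 * m + (3 + 1))) + 1 + 1 := by ring
    rw [this]
    refine push w w0 n0 (.add (.smul _ (.mem (by simp))) (.smul _ (.mem (by simp)))) (by simp) ?_
    refine push z z0 n1 (.const 0) (by simp) ?_
    refine call ca n2 (by simp) (by simp) ?_
    refine call cb (n2.cons a0) (by simp) (by simp) ?_
    refine (call (B' := 11) cc ((n2.cons a0).cons b0) (by simp) (by simp) (l' := [b, c]) (T' := 0)
      (.done (by simp))).trans (T' := 3 + 1) ?_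
    exact (clamp (.pair b0 c0) (.sub (.mem (by simp)) (.mem (by simp)))).mono (by simp) (by simp)
  · have h1 : u x * v x ≤ 1 := mul_le_one₀ (u1 x) (v0 x) (v1 x)
    refine (abs_clamp01_sub_le (mul_nonneg (u0 x) (v0 x)) h1).trans ?_
    have e1 := abs_le.1 (ea x)
    have e2 := abs_le.1 (eb x)
    have e3 := abs_le.1 (ec x)
    -- Polarisation, written with `t * (1 - t)` in place of squares; the three approximation errors
    -- add up to `3 / 4 ^ m`.
    have e4 : u x * v x = w x + 1 / 2 * (u x * (1 - u x)) + 1 / 2 * (v x * (1 - v x)) -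
        2 * (w x * (1 - w x)) := by simp only [hw]; ring
    have e5 : (3 : ℝ) / 4 ^ m = 1 / 2 / 4 ^ m + 1 / 2 / 4 ^ m + 2 / 4 ^ m := by ring
    rw [abs_le, e5, e4]
    simp only [hz] at e3
    constructor <;> linarith [e1.1, e1.2, e2.1, e2.2, e3.1, e3.2]

/-! ### Tables, bit extraction and digits. -/

/-- Look up a value in a table of `n` nonnegative numbers. -/
theorem exists_lookup (n : ℕ) (θ : ℕ → ℝ) (hθ : ∀ i, 0 ≤ θ i) {A : X → ℝ} (hA : ∀ x, 0 ≤ A x) :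
    ∃ h : X → ℝ, (∀ x, 0 ≤ h x) ∧ Computes 9 (n * 5 + 1) [A] [h] ∧
      ∀ x (i : ℕ), i < n → A x = i → h x = θ i := by
  have h0 : ∀ i : ℕ, ∀ x, 0 ≤ θ i * _root_.hat i (A x) := fun i x => mul_nonneg (hθ i) (hat_nonneg _ _)
  refine ⟨fun x => ∑ i ∈ Finset.range n, θ i * _root_.hat i (A x),
    fun x => Finset.sum_nonneg fun i _ => h0 i x, ?_, fun x i hi hx => ?_⟩
  · refine (sum_range (B := 5) (T := 4) (F := fun i x => θ i * _root_.hat i (A x)) (.singleton hA)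
      (fun i _ => h0 i) (fun i _ => ?_)).mono (by simp) (by simp)
    refine ((hat (l := [A]) (f := A) (.singleton hA) (.mem (by simp)) (i : ℝ)).mono (by simp) le_rfl).trans (T := 3) (T' := 1) ?_
    exact push (T := 0) (fun x => θ i * _root_.hat i (A x)) (h0 i) (.singleton fun _ => hat_nonneg _ _)
      (.smul _ (.mem (by simp))) (by simp) (.done (by simp))
  · simp only [hx, hat_natCast]
    rw [Finset.sum_eq_single i] <;> simp +contextual [hi]

end Computes

/-- The bits `bit i, …, bit (i + n - 1)` stored as ternary digits. -/
noncomputable def packBits (bit : ℕ → Bool) : ℕ → ℕ → ℝ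
  | _, 0 => 0
  | i, n + 1 => ((if bit i then 1 else 0) + packBits bit (i + 1) n) / 3

/-- The bound `1 / 2` is why base three is used: a leading bit `0` gives a value at most `1 / 6`, a
leading bit `1` a value at least `1 / 3`, and a continuous function can tell them apart. -/
theorem packBits_mem (bit : ℕ → Bool) (n : ℕ) : ∀ i,
    0 ≤ packBits bit i n ∧ packBits bit i n ≤ 1 / 2 := by
  induction n with
  | zero => intro i; simp [packBits]
  | succ n ih =>
    intro i
    have := ih (i + 1)
    unfold packBits
    split_ifs <;> constructor <;> linarith

namespace Computes

variable {X : Type}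

/-- Extract a bit at a given position. -/
theorem exists_extract (n : ℕ) : ∀ (i : ℕ) (θ P acc : X → ℝ), (∀ x, 0 ≤ θ x) → (∀ x, 0 ≤ P x) →
    (∀ x, 0 ≤ acc x) → ∃ h : X → ℝ, (∀ x, 0 ≤ h x) ∧ Computes 9 (n * 9) [θ, P, acc] [h] ∧
      ∀ x (bit : ℕ → Bool) (j : ℕ), θ x = packBits bit i n → P x = j →
        h x = acc x + if i ≤ j ∧ j < i + n ∧ bit j = true then 1 else 0 := by
  induction n with
  | zero =>
    intro i θ P acc hθ hP ha
    refine ⟨acc, ha, .done (by simp), fun x bit j _ _ => ?_⟩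
    rw [if_neg (by omega), add_zero]
  | succ n ih =>
    intro i θ P acc hθ hP ha
    -- `b` is the leading bit, `q` tests whether the position is `i`, and `p` is their conjunction;
    -- `θ'` is the code with its leading digit removed.
    set b : X → ℝ := fun x => clamp01 (6 * θ x - 1) with hb
    set q : X → ℝ := fun x => _root_.hat i (P x) with hq
    set p : X → ℝ := fun x => max 0 (b x + q x - 1) with hp
    set acc' : X → ℝ := fun x => acc x + p x with hacc'
    set θ' : X → ℝ := fun x => max 0 (3 * θ x - b x) with hθ'
    have b0 : ∀ x, 0 ≤ b x := fun x => clamp01_nonneg _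
    have q0 : ∀ x, 0 ≤ q x := fun x => hat_nonneg _ _
    have p0 : ∀ x, 0 ≤ p x := fun x => le_max_left _ _
    have a0 : ∀ x, 0 ≤ acc' x := fun x => add_nonneg (ha x) (p0 x)
    have t0 : ∀ x, 0 ≤ θ' x := fun x => le_max_left _ _
    obtain ⟨h, e1, e2, e3⟩ := ih (i + 1) θ' P acc' t0 hP a0
    refine ⟨h, e1, ?_, fun x bit j h1 h2 => ?_⟩
    · have n0 : AllNonneg [θ, P, acc] := .cons hθ (.pair hP ha)
      have n1 : AllNonneg [θ, P] := .pair hθ hP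
      have : (n + 1) * 9 = 3 + (3 + (n * 9 + 1 + 1 + 1)) := by ring
      rw [this]
      refine call (h := b) (clamp (l := [θ]) (.singleton hθ)
        (.sub (.smul 6 (.mem (by simp))) (.const 1))) n0 (by simp) (by simp) ?_
      refine call (h := q) (hat (l := [P]) (.singleton hP) (.mem (by simp)) (i : ℝ))
        (n0.cons b0) (by simp) (by simp) ?_
      refine push_relu (fun x => b x + q x - 1) ((n0.cons b0).cons q0)
        (.sub (.add (.mem (by simp)) (.mem (by simp))) (.const 1)) (by simp) ?_
      refine push acc' a0 (((n0.cons b0).cons q0).cons p0)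
        (.add (.mem (by simp)) (.mem (by simp [hp]))) (by simp) ?_
      refine push_relu (fun x => 3 * θ x - b x) ((((n0.cons b0).cons q0).cons p0).cons a0)
        (.sub (.smul 3 (.mem (by simp))) (.mem (by simp))) (by simp) ?_
      exact e2.of_subset (by simp [hθ'])
    · obtain ⟨m1, m2⟩ := packBits_mem bit n (i + 1)
      have hbx : b x = if bit i then 1 else 0 := by
        simp only [hb, h1, packBits]
        split_ifs
        · exact clamp01_of_one_le (by linarith)
        · exact clamp01_of_nonpos (by linarith)
      have hθx : θ' x = packBits bit (i + 1) n := by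
        simp only [hθ', hbx]
        rw [h1, packBits]
        rw [max_eq_right (by linarith)]
        ring
      rw [e3 x bit j hθx h2]
      simp only [hacc', hp, hbx, hq, h2, hat_natCast]
      rcases eq_or_ne i j with rfl | hij
      · by_cases hbi : bit i = true
        · simp [hbi]
        · simp [hbi]
      · have : (i + 1 ≤ j ∧ j < i + 1 + n ∧ bit j = true) ↔
            (i ≤ j ∧ j < i + (n + 1) ∧ bit j = true) :=
          ⟨fun h => ⟨by omega, by omega, h.2.2⟩, fun h => ⟨by omega, by omega, h.2.2⟩⟩
        simp only [this, if_neg hij]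
        rw [max_eq_left]
        · ring
        · split_ifs <;> norm_num

/-- Look up a bit in a table of `n` rows of `n` bits. -/
theorem exists_bit (n : ℕ) (bit : ℕ → ℕ → Bool) {A P : X → ℝ} (hA : ∀ x, 0 ≤ A x)
    (hP : ∀ x, 0 ≤ P x) : ∃ h : X → ℝ, (∀ x, 0 ≤ h x) ∧ Computes 12 (n * 14 + 2) [A, P] [h] ∧
      ∀ x (i j : ℕ), i < n → j < n → A x = i → P x = j → h x = if bit i j then 1 else 0 := by
  obtain ⟨θ, t0, ct, et⟩ := exists_lookup n (fun i => packBits (bit i) 0 n)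
    (fun i => (packBits_mem _ _ _).1) hA
  set z : X → ℝ := fun _ => 0 with hz
  have z0 : ∀ x, 0 ≤ z x := fun _ => le_rfl
  obtain ⟨h, h0, ch, eh⟩ := exists_extract n 0 θ P z t0 hP z0
  refine ⟨h, h0, ?_, fun x i j hi hj hAx hPx => ?_⟩
  · have n0 : AllNonneg [A, P] := .pair hA hP
    have : n * 14 + 2 = n * 5 + 1 + (n * 9 + 1) := by ring
    rw [this]
    refine call ct n0 (by simp) (by simp) ?_
    refine push z z0 (n0.cons t0) (.const 0) (by simp) ?_
    exact (ch.mono (by simp) le_rfl).of_subset (by simp)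
  · rw [eh x (bit i) j (et x i hi hAx) hPx]
    simp [hz, hj]

/-- The leading digit: `u / r` rounded down to a natural number below `n`, off small gaps. -/
theorem exists_digit (n : ℕ) (r δ : ℝ) (hδ : 0 < δ) {l : List (X → ℝ)} (hl : AllNonneg l)
    {u : X → ℝ} (hu : IsAff l u) : ∃ h : X → ℝ, (∀ x, 0 ≤ h x) ∧
      Computes (2 * l.length + 6) (n * 4 + 1) l [h] ∧
      ∀ x, 0 ≤ u x → u x ≤ (n + 1) * r → 0 < r →
        (∀ j : ℕ, 1 ≤ j → j ≤ n → u x ≤ j * r - δ ∨ j * r ≤ u x) →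
        ∃ a : ℕ, a ≤ n ∧ h x = a ∧ a * r ≤ u x ∧ u x ≤ (a + 1) * r := by
  have haff : ∀ i : ℕ, IsAff l (fun x => 1 / δ * (u x - ((i + 1 : ℕ) * r - δ))) := fun i =>
    .smul _ (hu.sub (.const _))
  refine ⟨fun x => ∑ i ∈ Finset.range n, clamp01 (1 / δ * (u x - ((i + 1 : ℕ) * r - δ))),
    fun x => Finset.sum_nonneg fun i _ => clamp01_nonneg _, ?_, fun x h0 h1 hr hgap => ?_⟩
  · exact (sum_range hl (F := fun i x => clamp01 (1 / δ * (u x - ((i + 1 : ℕ) * r - δ))))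
      (fun i _ x => clamp01_nonneg _) (fun i _ => clamp hl (haff i))).mono (by omega) (by omega)
  -- Off the gaps each ramp is `0` or `1`, so the sum counts the thresholds below `u`. The upper
  -- bound on `u` is claimed only for `a < m`, once some threshold has been missed.
  · suffices H : ∀ m : ℕ, m ≤ n → ∃ a : ℕ, a ≤ m ∧
        ∑ i ∈ Finset.range m, clamp01 (1 / δ * (u x - ((i + 1 : ℕ) * r - δ))) = a ∧
        a * r ≤ u x ∧ (a < m → u x ≤ (a + 1) * r) by
      obtain ⟨a, ha, e1, e2, e3⟩ := H n le_rfl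
      refine ⟨a, ha, e1, e2, ?_⟩
      rcases ha.lt_or_eq with h | rfl
      · exact e3 h
      · exact h1
    intro m
    induction m with
    | zero => intro _; exact ⟨0, le_rfl, by simp, by simpa using h0, by simp⟩
    | succ m ih =>
      intro hm
      obtain ⟨a, ha, e1, e2, e3⟩ := ih (by omega)
      rw [Finset.sum_range_succ, e1]
      rcases hgap (m + 1) (by omega) hm with h | h
      · refine ⟨a, by omega, ?_, e2, fun _ => ?_⟩
        · rw [clamp01_of_nonpos, add_zero]
          exact mul_nonpos_of_nonneg_of_nonpos (by positivity) (by linarith)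
        · rcases ha.lt_or_eq with h' | rfl
          · exact e3 h'
          · push_cast at h; linarith
      -- Passing threshold `m + 1` excludes having missed an earlier one.
      · have ham : a = m := by
          by_contra hne
          have h' : a < m := by omega
          have h2 := e3 h'
          have h3 : (a : ℝ) + 1 ≤ m := by exact_mod_cast h'
          push_cast at h
          nlinarith
        subst ham
        refine ⟨a + 1, le_rfl, ?_, h, by simp⟩
        rw [clamp01_of_one_le]
        · push_cast; ring
        · rw [one_div, inv_mul_eq_div, le_div_iff₀ hδ]
          linarith

end Computes

/-! ### Derivatives on the closed cube and Taylor approximation. -/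

section Cube

variable {d : ℕ}

theorem mem_unitCube {x : Fin d → ℝ} : x ∈ unitCube d ↔ ∀ i, 0 ≤ x i ∧ x i ≤ 1 := by
  simp [unitCube, Set.mem_Icc, Pi.le_def, forall_and]

theorem update_mem_unitCube {x : Fin d → ℝ} (hx : x ∈ unitCube d) (i : Fin d) {t : ℝ}
    (ht : t ∈ Set.Icc (0 : ℝ) 1) : Function.update x i t ∈ unitCube d := by
  rw [mem_unitCube] at hx ⊢
  intro j
  rcases eq_or_ne j i with rfl | h
  · simpa using ht
  · simpa [h] using hx j

theorem convex_unitCube : Convex ℝ (unitCube d) := convex_Icc _ _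

theorem interior_unitCube_nonempty : (interior (unitCube d)).Nonempty := by
  refine ⟨fun _ => 1 / 2, mem_interior.2
    ⟨Set.pi Set.univ fun _ => Set.Ioo 0 1, fun x hx => ?_, ?_, fun i _ => ?_⟩⟩
  · exact mem_unitCube.2 fun i => ⟨(hx i trivial).1.le, (hx i trivial).2.le⟩
  · exact isOpen_set_pi Set.finite_univ fun _ _ => isOpen_Ioo
  · norm_num

theorem uniqueDiffOn_unitCube : UniqueDiffOn ℝ (unitCube d) :=
  uniqueDiffOn_convex convex_unitCube interior_unitCube_nonempty

/-- The essential bound holds at every point, boundary included, because `g` is continuous and the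
cube is the closure of its interior. -/
theorem abs_le_one_of_cubeLInftyNorm_le_one {g : (Fin d → ℝ) → ℝ}
    (hg : ContinuousOn g (unitCube d)) (h : cubeLInftyNorm g ≤ 1) {x : Fin d → ℝ}
    (hx : x ∈ unitCube d) : |g x| ≤ 1 := by
  have h1 : ∀ᵐ y ∂(volume.restrict (unitCube d)), |g y| ≤ 1 := by
    have h2 := enorm_ae_le_eLpNormEssSup g (volume.restrict (unitCube d))
    filter_upwards [h2] with y hy
    have h3 : ‖g y‖ₑ ≤ 1 := hy.trans (by simpa [cubeLInftyNorm, eLpNorm_exponent_top] using h)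
    rw [Real.enorm_eq_ofReal_abs] at h3
    exact ENNReal.ofReal_le_one.1 h3
  have h4 : (fun y => max |g y| 1) =ᵐ[volume.restrict (unitCube d)] fun _ => (1 : ℝ) := by
    filter_upwards [h1] with y hy
    exact max_eq_right hy
  refine max_eq_right_iff.1 (Measure.eqOn_of_ae_eq h4 (hg.abs.sup continuousOn_const) continuousOn_const
    (fun y hy => ?_) hx)
  rw [convex_unitCube.closure_interior_eq_closure_of_nonempty_interior interior_unitCube_nonempty]
  exact subset_closure hy

theorem cubePartial_eq_fderivWithin {g : (Fin d → ℝ) → ℝ} {x : Fin d → ℝ} (hx : x ∈ unitCube d)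
    (hg : DifferentiableWithinAt ℝ g (unitCube d) x) (i : Fin d) :
    cubePartial i g x = fderivWithin ℝ g (unitCube d) x (Pi.single i 1) := by
  have h1 := (hg.hasFDerivWithinAt.hasLineDerivWithinAt (Pi.single i 1))
  refine HasDerivWithinAt.derivWithin h1 ?_
  have hxi := mem_unitCube.1 hx i
  -- The line meets the cube in a nondegenerate interval even when `x` is on a face, so the
  -- one-sided derivative is unique.
  have hpre : (fun t : ℝ => x + t • (Pi.single i 1 : Fin d → ℝ)) ⁻¹' unitCube d =
      Set.Icc (-x i) (1 - x i) := by
    ext t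
    simp only [Set.mem_preimage, mem_unitCube, Set.mem_Icc]
    constructor
    · intro h
      have := h i
      simp at this
      constructor <;> linarith [this.1, this.2]
    · intro h j
      rcases eq_or_ne j i with rfl | hj
      · simp
        constructor <;> linarith [h.1, h.2]
      · simpa [hj] using mem_unitCube.1 hx j
  rw [hpre]
  exact uniqueDiffOn_Icc (by linarith) 0 ⟨by linarith, by linarith⟩

theorem contDiffOn_cubePartial {g : (Fin d → ℝ) → ℝ} {n : ℕ}
    (hg : ContDiffOn ℝ (n + 1 : ℕ) g (unitCube d)) (i : Fin d) :
    ContDiffOn ℝ n (cubePartial i g) (unitCube d) := by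
  have h1 : ContDiffOn ℝ n (fderivWithin ℝ g (unitCube d)) (unitCube d) :=
    hg.fderivWithin uniqueDiffOn_unitCube (by norm_cast)
  refine (h1.clm_apply (contDiffOn_const (c := (Pi.single i 1 : Fin d → ℝ)))).congr
    fun x hx => ?_
  exact cubePartial_eq_fderivWithin hx (hg.differentiableOn (by simp) x hx) i

theorem contDiffOn_iterate_cubePartial (i : Fin d) (j : ℕ) :
    ∀ {g : (Fin d → ℝ) → ℝ} {n : ℕ}, ContDiffOn ℝ (n + j : ℕ) g (unitCube d) →
      ContDiffOn ℝ n ((cubePartial i)^[j] g) (unitCube d) := by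
  induction j with
  | zero => intro g n hg; simpa using hg
  | succ j ih =>
    intro g n hg
    rw [Function.iterate_succ_apply]
    exact ih (contDiffOn_cubePartial (n := n + j) hg i)

theorem hasDerivWithinAt_update {g : (Fin d → ℝ) → ℝ} {n : ℕ}
    (hg : ContDiffOn ℝ (n + 1 : ℕ) g (unitCube d)) {x : Fin d → ℝ} (hx : x ∈ unitCube d)
    (i : Fin d) {t : ℝ} (ht : t ∈ Set.Icc (0 : ℝ) 1) :
    HasDerivWithinAt (fun t => g (Function.update x i t))
      (cubePartial i g (Function.update x i t)) (Set.Icc 0 1) t := by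
  have hmem := update_mem_unitCube hx i ht
  have hd := hg.differentiableOn (by simp) _ hmem
  rw [cubePartial_eq_fderivWithin hmem hd i]
  exact hd.hasFDerivWithinAt.comp_hasDerivWithinAt t
    (hasDerivAt_update x i t).hasDerivWithinAt fun s hs => update_mem_unitCube hx i hs

/-- Taylor's formula for a chain of derivatives on `[0,1]`. -/
theorem abs_sub_taylor_le (m : ℕ) : ∀ (g : ℕ → ℝ → ℝ),
    (∀ j < m, ∀ t ∈ Set.Icc (0 : ℝ) 1, HasDerivWithinAt (g j) (g (j + 1) t) (Set.Icc 0 1) t) →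
    (∀ t ∈ Set.Icc (0 : ℝ) 1, |g m t| ≤ 1) → ∀ a ∈ Set.Icc (0 : ℝ) 1, ∀ t ∈ Set.Icc (0 : ℝ) 1,
    ∀ h, |t - a| ≤ h →
      |g 0 t - ∑ j ∈ Finset.range m, g j a / (j.factorial : ℝ) * (t - a) ^ j| ≤ h ^ m := by
  induction m with
  | zero => intro g _ hb a _ t ht h _; simpa using hb t ht
  | succ m ih =>
    intro g hd hb a ha t ht h hh
    have h0 : 0 ≤ h := (abs_nonneg _).trans hh
    set r : ℝ → ℝ := fun τ => g 0 τ -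
      ∑ j ∈ Finset.range (m + 1), g j a / (j.factorial : ℝ) * (τ - a) ^ j with hr
    have hsub : Set.uIcc a t ⊆ Set.Icc 0 1 := Set.uIcc_subset_Icc ha ht
    -- The derivative of the Taylor remainder is the remainder of one order less for the shifted
    -- chain; the mean value inequality then gains the factor `h`.
    have hder : ∀ τ ∈ Set.uIcc a t, HasDerivWithinAt r (g 1 τ -
        ∑ j ∈ Finset.range m, g (j + 1) a / (j.factorial : ℝ) * (τ - a) ^ j) (Set.uIcc a t) τ := by
      intro τ hτ
      refine ((hd 0 (by omega) τ (hsub hτ)).mono hsub).sub ?_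
      simp only [Finset.sum_range_succ']
      have : ∑ j ∈ Finset.range m, g (j + 1) a / (j.factorial : ℝ) * (τ - a) ^ j =
          ∑ j ∈ Finset.range m, g (j + 1) a / ((j + 1).factorial : ℝ) *
            (((j + 1 : ℕ) : ℝ) * (τ - a) ^ j * 1) + 0 := by
        rw [add_zero]
        refine Finset.sum_congr rfl fun j _ => ?_
        rw [Nat.factorial_succ]
        push_cast
        have h1 : (j.factorial : ℝ) ≠ 0 := by positivity
        have h2 : (j : ℝ) + 1 ≠ 0 := by positivity
        field_simp
      rw [this]
      refine HasDerivWithinAt.add (HasDerivWithinAt.fun_sum fun j _ => ?_) ?_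
      · exact ((((hasDerivAt_id τ).sub_const a).pow (j + 1)).const_mul _).hasDerivWithinAt
      · simpa using hasDerivWithinAt_const τ (Set.uIcc a t) (g 0 a)
    have hbound : ∀ τ ∈ Set.uIcc a t, ‖g 1 τ -
        ∑ j ∈ Finset.range m, g (j + 1) a / (j.factorial : ℝ) * (τ - a) ^ j‖ ≤ h ^ m := by
      intro τ hτ
      exact ih (fun j => g (j + 1)) (fun j hj => hd (j + 1) (by omega)) hb a ha τ (hsub hτ) h
        ((Set.abs_sub_left_of_mem_uIcc hτ).trans hh)
    have hmv := (convex_uIcc a t).norm_image_sub_le_of_norm_hasDerivWithin_le hder hbound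
      Set.left_mem_uIcc Set.right_mem_uIcc
    have hra : r a = 0 := by
      simp only [hr, Finset.sum_range_succ']
      simp
    rw [hra, sub_zero, Real.norm_eq_abs, Real.norm_eq_abs] at hmv
    calc _ ≤ h ^ m * |t - a| := hmv
      _ ≤ h ^ m * h := by gcongr
      _ = h ^ (m + 1) := (pow_succ _ _).symm

/-- Partial derivatives in the variables of a list, the last one first. -/
noncomputable def listPartial (l : List (Fin d)) (α : Fin d → ℕ) (g : (Fin d → ℝ) → ℝ) :
    (Fin d → ℝ) → ℝ :=
  l.foldr (fun i g => (cubePartial i)^[α i] g) g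

theorem listPartial_concat (l : List (Fin d)) (i : Fin d) (α : Fin d → ℕ)
    (g : (Fin d → ℝ) → ℝ) :
    listPartial (l ++ [i]) α g = listPartial l α ((cubePartial i)^[α i] g) := by
  simp [listPartial]

theorem listPartial_congr {l : List (Fin d)} {α β : Fin d → ℕ} (h : ∀ i ∈ l, α i = β i)
    (g : (Fin d → ℝ) → ℝ) : listPartial l α g = listPartial l β g := by
  induction l with
  | nil => rfl
  | cons i l ih =>
    have := ih fun i hi => h i (by simp [hi])
    simp only [listPartial, List.foldr_cons] at this ⊢
    rw [this, h i (by simp)]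

theorem listPartial_zero (l : List (Fin d)) (g : (Fin d → ℝ) → ℝ) : listPartial l 0 g = g := by
  induction l with
  | nil => rfl
  | cons i l ih => simp [listPartial]

/-- The monomial given by a word in the variables. -/
noncomputable def wordEval (z : Fin d → ℝ) (w : List (Fin d)) : ℝ := (w.map z).prod

theorem wordEval_congr {z z' : Fin d → ℝ} {w : List (Fin d)} (h : ∀ i ∈ w, z i = z' i) :
    wordEval z w = wordEval z' w := by
  unfold wordEval
  rw [List.map_congr_left h]

/-- Local polynomial approximation in the variables of a list. -/
theorem exists_taylor_list (l : List (Fin d)) (hl : l.Nodup) : ∀ m : ℕ,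
    ∃ (ι : Type) (_ : Fintype ι) (w : ι → List (Fin d)) (C : ℝ), 0 ≤ C ∧
      (∀ e, ∀ i ∈ w e, i ∈ l) ∧
      ∀ g : (Fin d → ℝ) → ℝ, ContDiffOn ℝ m g (unitCube d) →
        (∀ α : Fin d → ℕ, ∑ i, α i ≤ m → ∀ x ∈ unitCube d, |listPartial l α g x| ≤ 1) →
        ∃ coef : ι → (Fin d → ℝ) → ℝ, (∀ e, ∀ x ∈ unitCube d, |coef e x| ≤ 1) ∧
          ∀ x ∈ unitCube d, ∀ x₀ ∈ unitCube d, (∀ i, i ∉ l → x i = x₀ i) →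
            ∀ h : ℝ, (∀ i, |x i - x₀ i| ≤ h) → 0 ≤ h →
              |g x - ∑ e, coef e x₀ * wordEval (x - x₀) (w e)| ≤ C * h ^ m := by
  induction l using List.reverseRecOn with
  | nil =>
    intro m
    refine ⟨Unit, inferInstance, fun _ => [], 0, le_rfl, by simp, fun g _ hb =>
      ⟨fun _ => g, fun _ x hx => ?_, fun x _ x₀ _ hxx h _ _ => ?_⟩⟩
    · simpa [listPartial] using hb 0 (by simp) x hx
    · have : x = x₀ := funext fun i => hxx i (by simp)
      simp [this, wordEval]
  | append_singleton l i ih =>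
    intro m
    have hnd : l.Nodup ∧ i ∉ l := by
      rw [List.nodup_append] at hl
      exact ⟨hl.1, fun h => hl.2.2 i h i (by simp) rfl⟩
    -- Expand first in the variable `i`, then each `∂ᵢʲ g` to order `m - j` in the remaining ones.
    -- The words and constants are fixed before `g` appears, so they are uniform over the unit ball.
    choose ι hι w C hC hw H using fun j : Fin m => ih hnd.1 (m - j)
    refine ⟨Σ j : Fin m, ι j, inferInstance, fun e => List.replicate e.1 i ++ w e.1 e.2,
      1 + ∑ j, C j, add_nonneg zero_le_one (Finset.sum_nonneg fun j _ => hC j), ?_, ?_⟩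
    · rintro ⟨j, e⟩ k hk
      rcases List.mem_append.1 hk with hk | hk
      · simp [List.eq_of_mem_replicate hk]
      · simp [hw j e k hk]
    intro g hg hb
    have hb' : ∀ j ≤ m, ∀ β : Fin d → ℕ, ∑ i, β i ≤ m - j → ∀ x ∈ unitCube d,
        |listPartial l β ((cubePartial i)^[j] g) x| ≤ 1 := by
      intro j hj β hβ x hx
      have h1 : ∑ k, Function.update β i j k ≤ m := by
        rw [Finset.sum_update_of_mem (Finset.mem_univ i)]
        have : ∑ k ∈ Finset.univ \ {i}, β k ≤ ∑ k, β k :=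
          Finset.sum_le_sum_of_subset (by simp)
        omega
      have h2 := hb (Function.update β i j) h1 x hx
      rw [listPartial_concat, Function.update_self] at h2
      rwa [listPartial_congr (β := β)] at h2
      intro k hk
      rw [Function.update_of_ne]
      rintro rfl
      exact hnd.2 hk
    have hcd : ∀ j ≤ m, ContDiffOn ℝ (m - j : ℕ) ((cubePartial i)^[j] g) (unitCube d) := by
      intro j hj
      refine contDiffOn_iterate_cubePartial i j ?_
      rwa [Nat.sub_add_cancel hj]
    choose coef hcoef Hc using fun j : Fin m =>
      H j _ (hcd j j.2.le) (hb' j j.2.le)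
    refine ⟨fun e x => coef e.1 e.2 x / ((e.1 : ℕ).factorial : ℝ), ?_, ?_⟩
    · rintro ⟨j, e⟩ x hx
      rw [abs_div, Nat.abs_cast]
      refine div_le_one_of_le₀ ((hcoef j e x hx).trans ?_) (by positivity)
      exact_mod_cast Nat.one_le_iff_ne_zero.2 (Nat.factorial_ne_zero _)
    intro x hx x₀ hx₀ hxx h hh h0
    -- The intermediate point: `x` and `x'` differ only in coordinate `i`, while `x'` and `x₀`
    -- differ only in coordinates from `l`.
    set x' := Function.update x i (x₀ i) with hx'
    have hxi := mem_unitCube.1 hx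
    have hx₀i := mem_unitCube.1 hx₀
    have hx'm : x' ∈ unitCube d := update_mem_unitCube hx i (hx₀i i)
    have t1 := abs_sub_taylor_le m (fun j t => (cubePartial i)^[j] g (Function.update x i t))
      (fun j hj t ht => by
        rw [Function.iterate_succ_apply']
        obtain ⟨n, hn⟩ : ∃ n, m - j = n + 1 := ⟨m - j - 1, by omega⟩
        exact hasDerivWithinAt_update (hn ▸ hcd j hj.le) hx i ht)
      (fun t ht => by
        have := hb' m le_rfl 0 (by simp) _ (update_mem_unitCube hx i ht)
        rwa [listPartial_zero] at this)
      (x₀ i) (hx₀i i) (x i) (hxi i) h (hh i)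
    simp only [Function.update_eq_self, Function.iterate_zero, id_eq] at t1
    rw [Finset.sum_range] at t1
    have t2 : ∀ j : Fin m, |(cubePartial i)^[j] g x' -
        ∑ e, coef j e x₀ * wordEval (x - x₀) (w j e)| ≤ C j * h ^ (m - j : ℕ) := by
      intro j
      have := Hc j x' hx'm x₀ hx₀ (fun k hk => ?_) h (fun k => ?_) h0
      · convert this using 5 with e
        refine wordEval_congr fun k hk => ?_
        have hki : k ≠ i := fun h => hnd.2 (h ▸ hw j e k hk)
        simp [hx', hki]
      · rcases eq_or_ne k i with rfl | hki
        · simp [hx']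
        · simpa [hx', hki] using hxx k (by simp [hk, hki])
      · rcases eq_or_ne k i with rfl | hki
        · simpa [hx'] using h0
        · simpa [hx', hki] using hh k
    have t3 : ∑ e : (Σ j : Fin m, ι j), coef e.1 e.2 x₀ / ((e.1 : ℕ).factorial : ℝ) *
          wordEval (x - x₀) (List.replicate e.1 i ++ w e.1 e.2) =
        ∑ j : Fin m, (∑ e, coef j e x₀ * wordEval (x - x₀) (w j e)) / ((j : ℕ).factorial : ℝ) *
          (x i - x₀ i) ^ (j : ℕ) := by
      rw [Fintype.sum_sigma]
      refine Finset.sum_congr rfl fun j _ => ?_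
      rw [Finset.sum_div, Finset.sum_mul]
      refine Finset.sum_congr rfl fun e _ => ?_
      simp only [wordEval, List.map_append, List.prod_append, List.map_replicate,
        List.prod_replicate, Pi.sub_apply]
      ring
    rw [t3]
    have t4 : |∑ j : Fin m, (cubePartial i)^[j] g x' / ((j : ℕ).factorial : ℝ) *
          (x i - x₀ i) ^ (j : ℕ) -
        ∑ j : Fin m, (∑ e, coef j e x₀ * wordEval (x - x₀) (w j e)) / ((j : ℕ).factorial : ℝ) *
          (x i - x₀ i) ^ (j : ℕ)| ≤ (∑ j, C j) * h ^ m := by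
      rw [← Finset.sum_sub_distrib, Finset.sum_mul]
      refine (Finset.abs_sum_le_sum_abs _ _).trans (Finset.sum_le_sum fun j _ => ?_)
      rw [← sub_mul, ← sub_div, abs_mul, abs_div, Nat.abs_cast, abs_pow]
      have h1 : (1 : ℝ) ≤ (j : ℕ).factorial := by
        exact_mod_cast Nat.one_le_iff_ne_zero.2 (Nat.factorial_ne_zero _)
      calc _ ≤ (C j * h ^ (m - j : ℕ)) * h ^ (j : ℕ) := by
            refine mul_le_mul ((div_le_self (abs_nonneg _) h1).trans (t2 j))
              (pow_le_pow_left₀ (abs_nonneg _) (hh i) _) (by positivity)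
              (mul_nonneg (hC j) (by positivity))
        _ = C j * h ^ m := by
            rw [mul_assoc, ← pow_add, Nat.sub_add_cancel j.2.le]
    have t5 := abs_add_le (g x - ∑ j : Fin m, (cubePartial i)^[j] g x' / ((j : ℕ).factorial : ℝ) *
          (x i - x₀ i) ^ (j : ℕ)) (∑ j : Fin m, (cubePartial i)^[j] g x' / ((j : ℕ).factorial : ℝ) *
          (x i - x₀ i) ^ (j : ℕ) -
        ∑ j : Fin m, (∑ e, coef j e x₀ * wordEval (x - x₀) (w j e)) / ((j : ℕ).factorial : ℝ) *
          (x i - x₀ i) ^ (j : ℕ))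
    rw [sub_add_sub_cancel] at t5
    linarith

theorem contDiffOn_listPartial (l : List (Fin d)) (hl : l.Nodup) (α : Fin d → ℕ) :
    ∀ {g : (Fin d → ℝ) → ℝ} {m : ℕ}, ContDiffOn ℝ m g (unitCube d) → (l.map α).sum ≤ m →
      ContinuousOn (listPartial l α g) (unitCube d) := by
  induction l using List.reverseRecOn with
  | nil => intro g m hg _; exact hg.continuousOn
  | append_singleton l i ih =>
    intro g m hg hm
    rw [listPartial_concat]
    simp only [List.map_append, List.sum_append, List.map_cons, List.map_nil, List.sum_cons,
      List.sum_nil, add_zero] at hm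
    refine ih (List.nodup_append.1 hl).1 (m := m - α i)
      (contDiffOn_iterate_cubePartial i (α i) ?_) (by omega)
    rwa [Nat.sub_add_cancel (by omega)]

/-- Local polynomial approximation of functions in the unit ball of `C^s`. -/
theorem exists_taylor (d s : ℕ) : ∃ (ι : Type) (_ : Fintype ι) (w : ι → List (Fin d)) (C : ℝ),
    0 ≤ C ∧ ∀ f ∈ CsUnitBall d s, ∃ coef : ι → (Fin d → ℝ) → ℝ,
      (∀ e, ∀ x ∈ unitCube d, |coef e x| ≤ 1) ∧
      ∀ x ∈ unitCube d, ∀ x₀ ∈ unitCube d, ∀ h : ℝ, (∀ i, |x i - x₀ i| ≤ h) → 0 ≤ h →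
        |f x - ∑ e, coef e x₀ * wordEval (x - x₀) (w e)| ≤ C * h ^ s := by
  obtain ⟨ι, hι, w, C, hC, -, H⟩ := exists_taylor_list (List.finRange d) (List.nodup_finRange d) s
  refine ⟨ι, hι, w, C, hC, fun f hf => ?_⟩
  obtain ⟨coef, h1, h2⟩ := H f hf.1 fun α hα x hx => by
    refine abs_le_one_of_cubeLInftyNorm_le_one ?_ (hf.2 α hα) hx
    refine contDiffOn_listPartial _ (List.nodup_finRange d) α hf.1 ?_
    rwa [← List.ofFn_eq_map, List.sum_ofFn]
  exact ⟨coef, h1, fun x hx x₀ hx₀ h hh h0 =>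
    h2 x hx x₀ hx₀ (fun i hi => absurd (List.mem_finRange i) hi) h hh h0⟩

end Cube

/-! ### Assembling the local polynomials off the gaps. -/

theorem AllNonneg.append {X : Type} {l l' : List (X → ℝ)} (h : AllNonneg l) (h' : AllNonneg l') :
    AllNonneg (l ++ l') := fun g hg => (List.mem_append.1 hg).elim (h g) (h' g)

theorem AllNonneg.ofFn {X : Type} {n : ℕ} {y : Fin n → X → ℝ} (h : ∀ i x, 0 ≤ y i x) :
    AllNonneg (List.ofFn y) := by
  intro g hg
  obtain ⟨i, rfl⟩ := List.mem_ofFn.1 hg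
  exact h i

/-- Binary expansion to `M` digits. -/
theorem exists_binary (M : ℕ) : ∀ q : ℝ, 0 ≤ q → q ≤ 1 → ∃ b : ℕ → Bool,
    |q - ∑ t ∈ Finset.range M, (if b t then 1 else 0) / (2 : ℝ) ^ (t + 1)| ≤ 1 / 2 ^ M := by
  induction M with
  | zero => intro q h0 h1; exact ⟨fun _ => false, by simpa [abs_of_nonneg h0] using h1⟩
  | succ M ih =>
    intro q h0 h1
    obtain ⟨b₀, hb0, hb1⟩ : ∃ b₀ : Bool, 0 ≤ 2 * q - (if b₀ then 1 else 0) ∧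
        2 * q - (if b₀ then 1 else 0) ≤ 1 := by
      rcases le_total q (1 / 2) with h | h
      · exact ⟨false, by constructor <;> simp <;> linarith⟩
      · exact ⟨true, by constructor <;> simp <;> linarith⟩
    obtain ⟨b, hb⟩ := ih _ hb0 hb1
    refine ⟨fun t => t.casesOn b₀ b, ?_⟩
    rw [Finset.sum_range_succ']
    have e : ∀ S : ℝ, q - (S / 2 + (if b₀ then 1 else 0) / 2 ^ (0 + 1)) =
        (2 * q - (if b₀ then 1 else 0) - S) / 2 := by intro S; ring
    have e2 : ∑ t ∈ Finset.range M, (if b t then (1 : ℝ) else 0) / (2 : ℝ) ^ (t + 1 + 1) =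
        (∑ t ∈ Finset.range M, (if b t then (1 : ℝ) else 0) / (2 : ℝ) ^ (t + 1)) / 2 := by
      rw [Finset.sum_div]
      refine Finset.sum_congr rfl fun t _ => ?_
      rw [pow_succ _ (t + 1), div_div]
    have e3 := e (∑ t ∈ Finset.range M, (if b t then (1 : ℝ) else 0) / (2 : ℝ) ^ (t + 1))
    rw [← e2] at e3
    refine (congrArg abs e3).le.trans ?_
    rw [ abs_div, abs_two, pow_succ, ← div_div]
    gcongr

/-- Digits in base `k` are recovered from a number. -/
theorem sum_digits_decode {d k : ℕ} {α : Fin d → ℕ} (hα : ∀ i, α i < k) :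
    ∑ i, α i * k ^ (i : ℕ) < k ^ d ∧ ∀ j : Fin d, (∑ i, α i * k ^ (i : ℕ)) / k ^ (j : ℕ) % k = α j := by
  set a : Fin d → Fin k := fun i => ⟨α i, hα i⟩
  have h1 : (finFunctionFinEquiv a : ℕ) = ∑ i, α i * k ^ (i : ℕ) := finFunctionFinEquiv_apply a
  refine ⟨h1 ▸ (finFunctionFinEquiv a).2, fun j => ?_⟩
  have h2 := congrFun (finFunctionFinEquiv.symm_apply_apply a) j
  have h3 := finFunctionFinEquiv_symm_apply_val (finFunctionFinEquiv a) j
  rw [h2, h1] at h3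
  exact h3.symm

/-- `u` avoids the gaps of length `δ` to the left of the grid points `j / k ^ 2`. -/
def AvoidsGaps (k : ℕ) (δ u : ℝ) : Prop :=
  ∀ j : ℕ, 1 ≤ j → j < k * k → u ≤ j * (1 / (k * k) : ℝ) - δ ∨ j * (1 / (k * k) : ℝ) ≤ u

namespace Computes

variable {X : Type} {B T : ℕ} {l : List (X → ℝ)}

/-- Compute several functions in turn. -/
theorem list (hl : AllNonneg l) (L : List (X → ℝ)) (hL : AllNonneg L)
    (h : ∀ f ∈ L, Computes B T l [f]) :
    Computes (B + L.length + l.length) (L.length * T) l (L ++ l) := by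
  induction L with
  | nil => exact .done (by simp)
  | cons f L ih =>
    have hL' : AllNonneg L := hL.subset (by simp)
    have h1 := ih hL' fun g hg => h g (by simp [hg])
    have h2 : Computes (B + (f :: L).length + l.length) (T + 0) (L ++ l) (f :: L ++ l) :=
      call (h f (by simp)) (hL'.append hl) (by simp) (by simp; omega) (.done (by simp))
    exact ((h1.mono (by simp) le_rfl).trans h2).mono le_rfl (by simp [Nat.add_mul])

/-- Grid cell and offset of one coordinate. -/
theorem exists_coord {k : ℕ} (hk : 1 ≤ k) {δ : ℝ} (hδ : 0 < δ) {y : X → ℝ} (y0 : ∀ x, 0 ≤ y x)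
    (y1 : ∀ x, y x ≤ 1) : ∃ a b z : X → ℝ, (∀ x, 0 ≤ a x) ∧ (∀ x, 0 ≤ b x) ∧ (∀ x, 0 ≤ z x) ∧
      (∀ x, z x ≤ 1) ∧ Computes 20 (24 * k) [y] [a] ∧ Computes 20 (24 * k) [y] [b] ∧
      Computes 20 (24 * k) [y] [z] ∧ ∀ x, AvoidsGaps k δ (y x) → ∃ α β : ℕ, α < k ∧ β < k ∧
        a x = α ∧ b x = β ∧ z x = y x - (α * k + β) * (1 / (k * k)) ∧ z x ≤ 1 / (k * k) := by
  obtain ⟨n, rfl⟩ : ∃ n, k = n + 1 := ⟨k - 1, by omega⟩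
  have ny : AllNonneg [y] := .singleton y0
  obtain ⟨a, a0, ca, ea⟩ := exists_digit n (1 / (n + 1 : ℕ)) δ hδ ny (.mem (by simp) : IsAff [y] y)
  have nay : AllNonneg [a, y] := ny.cons a0
  obtain ⟨b, b0, cb, eb⟩ := exists_digit n (1 / ((n + 1 : ℕ) * (n + 1 : ℕ))) δ hδ nay
    (.sub (.mem (by simp)) (.smul (1 / (n + 1 : ℕ)) (.mem (by simp))) :
      IsAff [a, y] (fun x => y x - 1 / (n + 1 : ℕ) * a x))
  have cz : Computes 20 3 [b, a, y] [fun x => clamp01 (y x - 1 / (n + 1 : ℕ) * a x -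
      1 / ((n + 1 : ℕ) * (n + 1 : ℕ)) * b x)] :=
    (clamp (nay.cons b0) (.sub (.sub (.mem (by simp)) (.smul _ (.mem (by simp))))
      (.smul _ (.mem (by simp))))).mono (by simp) le_rfl
  have cba : Computes 12 (n * 4 + 1) [a, y] [b] := cb.mono (by simp) le_rfl
  refine ⟨a, b, _, a0, b0, fun x => clamp01_nonneg (y x - 1 / (n + 1 : ℕ) * a x -
      1 / ((n + 1 : ℕ) * (n + 1 : ℕ)) * b x), fun x => clamp01_le_one _,
    ca.mono (by simp) (by omega), ?_, ?_, fun x hx => ?_⟩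
  · exact (call (B' := 20) ca ny (by simp) (by simp) (cba.mono (by simp) le_rfl)).mono le_rfl
      (by omega)
  · exact (call (B' := 20) ca ny (by simp) (by simp)
      (call (B' := 20) cba nay (by simp) (by simp) cz)).mono le_rfl (by omega)
  · set K : ℝ := ((n + 1 : ℕ) : ℝ) with hK
    have hn : (n : ℝ) + 1 = K := by simp [hK]
    have K0 : 0 < K := by positivity
    have hKK : 1 / K = K * (1 / (K * K)) := by field_simp
    obtain ⟨α, hα, e1, e2, e3⟩ := ea x (y0 x) (by rw [hn, mul_one_div_cancel K0.ne']; exact y1 x)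
      (by positivity) fun j h1 h2 => by
        -- Coarse grid points are also fine grid points, so one gap condition serves both digits.
        have := hx (j * (n + 1)) (by nlinarith) (by nlinarith)
        push_cast at this
        rw [hn, mul_assoc, ← hKK] at this
        exact this
    have e2' : 1 / K * α ≤ y x := by linarith
    have e3' : y x ≤ 1 / K * α + 1 / K := by linarith
    obtain ⟨β, hβ, f1, f2, f3⟩ := eb x (by rw [e1]; linarith)
      (by rw [hn, ← hKK, e1]; linarith) (by positivity) fun j h1 h2 => by
        have := hx (α * (n + 1) + j) (by omega) (by nlinarith)
        push_cast at this
        rw [hn, add_mul, mul_assoc, ← hKK] at this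
        rw [e1]
        rcases this with h | h
        · left; linarith
        · right; linarith
    rw [e1] at f2 f3
    have g1 : 1 / K * (α : ℝ) = α * K * (1 / (K * K)) := by field_simp
    have g2 : 1 / (K * K) ≤ 1 := by
      rw [div_le_one (by positivity)]
      have : 1 ≤ K := by rw [← hn]; linarith [Nat.cast_nonneg (α := ℝ) n]
      nlinarith
    have g3 : y x - 1 / K * a x - 1 / (K * K) * b x = y x - (α * K + β) * (1 / (K * K)) := by
      rw [e1, f1, g1]; ring
    have g4 : clamp01 (y x - 1 / K * a x - 1 / (K * K) * b x) =
        y x - (α * K + β) * (1 / (K * K)) := by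
      rw [g3]
      refine clamp01_of_mem ?_ ?_ <;> linarith
    refine ⟨α, β, by omega, by omega, e1, f1, g4, ?_⟩
    rw [g4]
    linarith

/-- Approximate monomials. -/
theorem exists_word {d : ℕ} (m : ℕ) {z : Fin d → X → ℝ} (z0 : ∀ i x, 0 ≤ z i x)
    (z1 : ∀ i x, z i x ≤ 1) (w : List (Fin d)) : ∃ h : X → ℝ, (∀ x, 0 ≤ h x) ∧ (∀ x, h x ≤ 1) ∧
      Computes (d + 13) (w.length * (9 * m + 6) + 1) (List.ofFn z) (h :: List.ofFn z) ∧
      ∀ x, |h x - wordEval (fun i => z i x) w| ≤ w.length * (3 / 4 ^ m) := by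
  have nz : AllNonneg (List.ofFn z) := .ofFn z0
  induction w with
  | nil =>
    refine ⟨fun _ => 1, by simp, by simp, ?_, by simp [wordEval]⟩
    exact (push (T := 0) (fun _ => 1) (by simp) nz (.const 1) (by simp)
      (.done (by simp))).mono le_rfl (by simp)
  | cons i w ih =>
    obtain ⟨h, h0, h1, ch, eh⟩ := ih
    obtain ⟨g, g0, g1, cg, eg⟩ := exists_mul m (z0 i) (z1 i) h0 h1
    refine ⟨g, g0, g1, ?_, fun x => ?_⟩
    · refine (ch.trans (T' := 9 * m + 6 + 0) ?_).mono le_rfl (by simp [Nat.add_mul]; omega)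
      refine call cg (nz.cons h0) ?_ (by simp; omega) (.done ?_)
      · intro f hf
        simp only [List.mem_cons, List.not_mem_nil, or_false] at hf
        rcases hf with rfl | rfl
        · exact List.mem_cons_of_mem _ (List.mem_ofFn.2 ⟨i, rfl⟩)
        · simp
      · intro f hf
        rcases List.mem_cons.1 hf with rfl | hf
        · simp
        · simp [hf]
    · have e1 : wordEval (fun i => z i x) (i :: w) = z i x * wordEval (fun i => z i x) w := by
        simp [wordEval]
      have e2 := abs_add_le (g x - z i x * h x) (z i x * (h x - wordEval (fun i => z i x) w))
      have e3 : |z i x * (h x - wordEval (fun i => z i x) w)| ≤ w.length * (3 / 4 ^ m) := by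
        rw [abs_mul, abs_of_nonneg (z0 i x)]
        exact (mul_le_of_le_one_left (abs_nonneg _) (z1 i x)).trans (eh x)
      have e4 : g x - wordEval (fun i => z i x) (i :: w) =
          g x - z i x * h x + z i x * (h x - wordEval (fun i => z i x) w) := by rw [e1]; ring
      rw [e4, List.length_cons]
      push_cast
      linarith [eg x]

/-- A tabulated number in `[-1,1]`, given by its bits, times a register, plus one. -/
theorem exists_term (n M : ℕ) (bit : ℕ → ℕ → ℕ → Bool) {A P m : X → ℝ} (hA : ∀ x, 0 ≤ A x)
    (hP : ∀ x, 0 ≤ P x) (m0 : ∀ x, 0 ≤ m x) (m1 : ∀ x, m x ≤ 1) : ∃ h : X → ℝ, (∀ x, 0 ≤ h x) ∧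
      Computes 30 (M * (n * 14 + 5) + 2) [A, P, m] [h] ∧
      ∀ x (i j : ℕ), i < n → j < n → A x = i → P x = j → h x = 1 +
        (2 * ∑ t ∈ Finset.range M, (if bit i j t then 1 else 0) / (2 : ℝ) ^ (t + 1) - 1) * m x := by
  choose b b0 cb eb using fun t => exists_bit (X := X) n (fun i j => bit i j t) hA hP
  have n0 : AllNonneg [A, P, m] := .cons hA (.pair hP m0)
  -- For a bit `b` and `0 ≤ m ≤ 1`, `max 0 (b + m - 1)` is exactly `b * m`, so no approximate
  -- product is needed. The weight `1 / 2 ^ t` is twice the binary place value.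
  have F0 : ∀ t x, 0 ≤ 1 / (2 : ℝ) ^ t * max 0 (b t x + m x - 1) := fun t x =>
    mul_nonneg (by positivity) (le_max_left _ _)
  have cF : ∀ t < M, Computes 20 (n * 14 + 4) [A, P, m]
      [fun x => 1 / (2 : ℝ) ^ t * max 0 (b t x + m x - 1)] := by
    intro t _
    change Computes 20 (n * 14 + 2 + (1 + 1)) _ _
    refine call (cb t) n0 (by simp) (by simp) ?_
    refine push_relu (fun x => b t x + m x - 1) (n0.cons (b0 t))
      (.sub (.add (.mem (by simp)) (.mem (by simp))) (.const 1)) (by simp) ?_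
    exact push (T := 0) _ (F0 t) ((n0.cons (b0 t)).cons fun _ => le_max_left _ _)
      (.smul _ (.mem (by simp))) (by simp) (.done (by simp))
  have cS := sum_range n0 (fun t _ => F0 t) cF
  set S : X → ℝ := fun x => ∑ t ∈ Finset.range M, 1 / (2 : ℝ) ^ t * max 0 (b t x + m x - 1)
    with hS
  have S0 : ∀ x, 0 ≤ S x := fun x => Finset.sum_nonneg fun t _ => F0 t x
  refine ⟨fun x => max 0 (1 + S x - m x), fun x => le_max_left _ _, ?_,
    fun x i j hi hj hAx hPx => ?_⟩
  · change Computes 30 (M * (n * 14 + 5) + 1 + 1) _ _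
    refine call cS n0 (by simp) (by simp) ?_
    exact push_relu (T := 0) (fun x => 1 + S x - m x) (n0.cons S0)
      (.sub (.add (.const 1) (.mem (by simp))) (.mem (by simp))) (by simp) (.done (by simp))
  · have hSx : S x = 2 * (∑ t ∈ Finset.range M,
        (if bit i j t then 1 else 0) / (2 : ℝ) ^ (t + 1)) * m x := by
      simp only [hS]
      rw [Finset.mul_sum, Finset.sum_mul]
      refine Finset.sum_congr rfl fun t _ => ?_
      rw [eb t x i j hi hj hAx hPx]
      split_ifs
      · rw [add_sub_cancel_left, max_eq_right (m0 x), pow_succ]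
        field_simp
      · rw [max_eq_left (by linarith [m1 x])]
        simp
    have : 0 ≤ 1 + S x - m x := by linarith [S0 x, m1 x]
    simp only [max_eq_right this]
    rw [hSx]
    ring

end Computes

/-- Approximation off the gaps of the grid, by networks of bounded width. -/
theorem exists_computes_approx (d s : ℕ) (hd : 0 < d) : ∃ (B c : ℕ) (C N : ℝ), 1 ≤ B ∧ d ≤ B ∧ 0 ≤ C ∧
    ∀ k : ℕ, 1 ≤ k → ∀ f ∈ CsUnitBall d s, ∀ δ : ℝ, 0 < δ →
      ∀ (X : Type) (y : Fin d → X → ℝ), (∀ i x, 0 ≤ y i x) → (∀ i x, y i x ≤ 1) →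
        ∃ h : X → ℝ, (∀ x, 0 ≤ h x) ∧
          Computes B (c * (k ^ d * (Nat.log 2 k + 1))) (List.ofFn y) [h] ∧
          ∀ x, (∀ i, AvoidsGaps k δ (y i x)) →
            |h x - (f (fun i => y i x) + N)| ≤ C * (1 / (k * k)) ^ s := by
  obtain ⟨ι, hι, w, C, hC, H⟩ := exists_taylor d s
  set Λ : ℕ := ∑ e, (w e).length with hΛ
  have hw : ∀ e, (w e).length ≤ Λ := fun e =>
    Finset.single_le_sum (f := fun e => (w e).length) (fun _ _ => Nat.zero_le _) (Finset.mem_univ e)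
  refine ⟨100 + 10 * d + Fintype.card ι,
    72 * d + 3 + Fintype.card ι * (Λ * (18 * s + 6) + 38 * s + 3), C + Fintype.card ι * (2 + 3 * Λ),
    Fintype.card ι, by omega, by omega, by positivity, ?_⟩
  intro k hk f hf δ hδ X y y0 y1
  obtain ⟨coef, hcoef, Hf⟩ := H f hf
  set lam := Nat.log 2 k + 1 with hlam
  -- Enough bits for `2 ^ M ≥ k ^ (2 * s)`, since `k ≤ 2 ^ lam`; the same `M` sets the accuracy of
  -- the products.
  set M := 2 * s * lam with hM
  have k0 : (0 : ℝ) < k := by exact_mod_cast hk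
  have hMk : (1 : ℝ) / 2 ^ M ≤ (1 / (k * k)) ^ s := by
    rw [one_div_pow, ← pow_two, ← pow_mul]
    refine one_div_le_one_div_of_le (by positivity) ?_
    have h1 : (k : ℝ) ≤ 2 ^ lam := by exact_mod_cast (Nat.lt_pow_succ_log_self (by norm_num) k).le
    calc (k : ℝ) ^ (2 * s) ≤ (2 ^ lam) ^ (2 * s) := pow_le_pow_left₀ k0.le h1 _
      _ = 2 ^ M := by rw [← pow_mul, hM, mul_comm lam]
  set cell : ℕ → ℕ → Fin d → ℝ := fun i j l =>
    (((i / k ^ (l : ℕ) % k : ℕ) : ℝ) * k + ((j / k ^ (l : ℕ) % k : ℕ) : ℝ)) * (1 / (k * k))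
    with hcell
  -- The map `c ↦ (c + 1) / 2` brings coefficients into `[0,1]`. The clamp allows bits to be chosen
  -- for all `i`, `j` without side conditions and is inactive at the cells in use.
  choose bit hbit using fun (e : ι) (i j : ℕ) =>
    exists_binary M (clamp01 ((coef e (cell i j) + 1) / 2)) (clamp01_nonneg _) (clamp01_le_one _)
  choose a b z a0 b0 z0 z1 ca cb cz hx using fun i => Computes.exists_coord hk hδ (y0 i) (y1 i)
  set A : X → ℝ := fun x => ∑ i : Fin d, (k : ℝ) ^ (i : ℕ) * a i x with hA
  set P : X → ℝ := fun x => ∑ i : Fin d, (k : ℝ) ^ (i : ℕ) * b i x with hP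
  have A0 : ∀ x, 0 ≤ A x := fun x => Finset.sum_nonneg fun i _ => mul_nonneg (by positivity) (a0 i x)
  have P0 : ∀ x, 0 ≤ P x := fun x => Finset.sum_nonneg fun i _ => mul_nonneg (by positivity) (b0 i x)
  choose m m0 m1 cm em using fun e => Computes.exists_word M z0 z1 (w e)
  choose g g0 cg eg using fun e =>
    Computes.exists_term (k ^ d) M (bit e) A0 P0 (m0 e) (m1 e)
  have ny : AllNonneg (List.ofFn y) := .ofFn y0
  have nz : AllNonneg (List.ofFn z) := .ofFn z0
  have nAPz : AllNonneg (P :: A :: List.ofFn z) := (nz.cons A0).cons P0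
  set T := Λ * (9 * M + 6) + 1 + (M * (k ^ d * 14 + 5) + 2) with hT
  have cge : ∀ e, Computes (50 + 2 * d) T (P :: A :: List.ofFn z) [g e] := by
    intro e
    have h1 : Computes (d + 13) (Λ * (9 * M + 6) + 1) (List.ofFn z) [m e] :=
      (((cm e).trans (T' := 0) (.done (by simp))).mono le_rfl
        (by have := Nat.mul_le_mul_right (9 * M + 6) (hw e); omega))
    refine Computes.call h1 nAPz (by simp) (by simp; omega) ?_
    exact ((cg e).mono (by omega) le_rfl).of_subset (by simp)
  set L1 := List.ofFn a ++ (List.ofFn b ++ List.ofFn z) with hL1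
  have nL1 : AllNonneg L1 := (AllNonneg.ofFn a0).append ((AllNonneg.ofFn b0).append nz)
  have c1 : Computes (20 + L1.length + d) (L1.length * (24 * k)) (List.ofFn y)
      (L1 ++ List.ofFn y) := by
    refine (Computes.list (B := 20) (T := 24 * k) ny L1 nL1 fun f hf => ?_).mono (by simp) le_rfl
    have key : ∀ i (f : X → ℝ), Computes 20 (24 * k) [y i] [f] →
        Computes 20 (24 * k) (List.ofFn y) [f] := fun i f h => h.of_subset (by simp)
    simp only [hL1, List.mem_append, List.mem_ofFn] at hf
    rcases hf with ⟨i, rfl⟩ | ⟨i, rfl⟩ | ⟨i, rfl⟩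
    · exact key i _ (ca i)
    · exact key i _ (cb i)
    · exact key i _ (cz i)
  have hlen : L1.length = 3 * d := by simp [hL1]; ring
  have hmem : ∀ i, a i ∈ L1 ∧ b i ∈ L1 ∧ z i ∈ L1 := fun i => by simp [hL1, List.mem_ofFn]
  have c2 : Computes (4 * d + 22) 2 (L1 ++ List.ofFn y) (P :: A :: List.ofFn z) := by
    have n1 := nL1.append ny
    refine Computes.push A A0 n1
      (.sum _ fun i _ => .smul _ (.mem (List.mem_append_left _ (hmem i).1)))
      (by simp [hlen]; omega) ?_
    refine Computes.push (T := 0) P P0 (n1.cons A0)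
      (.sum _ fun i _ => .smul _ (.mem (List.mem_cons_of_mem _ (List.mem_append_left _ (hmem i).2.1))))
      (by simp [hlen]; omega) (.done ?_)
    intro f hf
    simp only [List.mem_cons, List.mem_ofFn] at hf
    rcases hf with rfl | rfl | ⟨i, rfl⟩
    · simp
    · simp
    · simp [(hmem i).2.2]
  set Lg := (Finset.univ : Finset ι).toList.map g with hLg
  have nLg : AllNonneg Lg := fun f hf => by
    obtain ⟨e, -, rfl⟩ := List.mem_map.1 hf
    exact g0 e
  have hLglen : Lg.length = Fintype.card ι := by simp [hLg]
  have c3 := Computes.list nAPz Lg nLg fun f hf => by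
    obtain ⟨e, -, rfl⟩ := List.mem_map.1 hf
    exact cge e
  have S0 : ∀ x, 0 ≤ ∑ e, g e x := fun x => Finset.sum_nonneg fun e _ => g0 e x
  have c4 : Computes (100 + 10 * d + Fintype.card ι) 1 (Lg ++ P :: A :: List.ofFn z)
      [fun x => ∑ e, g e x] := by
    refine Computes.push (T := 0) _ S0 (nLg.append nAPz) (.sum _ fun e _ => .mem ?_)
      (by simp [hLglen]; omega) (.done (by simp))
    exact List.mem_append_left _ (List.mem_map.2 ⟨e, by simp, rfl⟩)
  refine ⟨fun x => ∑ e, g e x, S0, ?_, fun x hgx => ?_⟩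
  · have c5 := ((c1.mono (B' := 100 + 10 * d + Fintype.card ι) (by omega) le_rfl).trans
      ((c2.mono (by omega) le_rfl).trans ((c3.mono (by simp [hLglen]; omega) le_rfl).trans c4)))
    refine c5.mono le_rfl ?_
    rw [hlen, hLglen, hT]
    set Q := k ^ d * lam with hQ
    have hlam1 : 1 ≤ lam := by omega
    have hkd1 : 1 ≤ k ^ d := Nat.one_le_pow _ _ hk
    -- The digit computations cost `O(k)` layers, which is absorbed because `d ≥ 1`.
    have hkQ : k ≤ Q := by
      calc k = k ^ 1 * 1 := by ring
        _ ≤ Q := Nat.mul_le_mul (Nat.pow_le_pow_right hk hd) hlam1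
    have hlQ : lam ≤ Q := by nlinarith
    have hQ1 : 1 ≤ Q := hk.trans hkQ
    have hMQ : M ≤ 2 * s * Q := Nat.mul_le_mul_left _ hlQ
    have h1 : M * (k ^ d * 14 + 5) ≤ 38 * s * Q := by
      calc M * (k ^ d * 14 + 5) = 28 * s * Q + 5 * M := by rw [hM, hQ]; ring
        _ ≤ 28 * s * Q + 5 * (2 * s * Q) := by gcongr
        _ = 38 * s * Q := by ring
    have h2 : Λ * (9 * M + 6) ≤ Λ * (18 * s + 6) * Q := by
      calc Λ * (9 * M + 6) ≤ Λ * (9 * (2 * s * Q) + 6 * Q) := by gcongr; omega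
        _ = _ := by ring
    calc 3 * d * (24 * k) + (2 + (Fintype.card ι * (Λ * (9 * M + 6) + 1 +
          (M * (k ^ d * 14 + 5) + 2)) + 1))
        ≤ 3 * d * (24 * Q) + (2 * Q + (Fintype.card ι * (Λ * (18 * s + 6) * Q + 1 * Q +
          (38 * s * Q + 2 * Q)) + 1 * Q)) := by gcongr <;> omega
      _ = _ := by ring
  · choose α β hα hβ hax hbx hzx hzk using fun i => hx i x (hgx i)
    obtain ⟨dα1, dα2⟩ := sum_digits_decode hα
    obtain ⟨dβ1, dβ2⟩ := sum_digits_decode hβ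
    set i₀ := ∑ i, α i * k ^ (i : ℕ) with hi₀
    set j₀ := ∑ i, β i * k ^ (i : ℕ) with hj₀
    have hAx : A x = i₀ := by
      simp only [hA, hi₀, hax]
      push_cast
      exact Finset.sum_congr rfl fun i _ => mul_comm _ _
    have hPx : P x = j₀ := by
      simp only [hP, hj₀, hbx]
      push_cast
      exact Finset.sum_congr rfl fun i _ => mul_comm _ _
    set x₀ := cell i₀ j₀ with hx₀
    have hx₀i : ∀ i, x₀ i = (α i * k + β i) * (1 / (k * k)) := fun i => by
      simp only [hx₀, hcell, dα2, dβ2]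
    have hzi : ∀ i, z i x = y i x - x₀ i := fun i => by rw [hzx, hx₀i]
    have hx₀m : x₀ ∈ unitCube d := mem_unitCube.2 fun i =>
      ⟨by rw [hx₀i]; positivity, by linarith [hzi i, z0 i x, y1 i x]⟩
    have hym : (fun i => y i x) ∈ unitCube d := mem_unitCube.2 fun i => ⟨y0 i x, y1 i x⟩
    have t1 := Hf _ hym x₀ hx₀m (1 / (k * k)) (fun i => by
      rw [← hzi, abs_of_nonneg (z0 i x)]; exact hzk i) (by positivity)
    have hsub : (fun i => y i x) - x₀ = fun i => z i x := funext fun i => (hzi i).symm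
    rw [hsub] at t1
    -- Each `g e` carries a `1` that keeps it nonnegative; these add up to the offset `N =
    -- Fintype.card ι`. The error splits into rounding of the coefficient and error of the monomial.
    have t2 : ∀ e, |g e x - 1 - coef e x₀ * wordEval (fun i => z i x) (w e)| ≤
        (2 + 3 * Λ) * (1 / (k * k)) ^ s := by
      intro e
      rw [eg e x i₀ j₀ dα1 dβ1 hAx hPx]
      have hc := abs_le.1 (hcoef e x₀ hx₀m)
      have hb := hbit e i₀ j₀
      rw [clamp01_of_mem (by linarith) (by linarith)] at hb
      set q := ∑ t ∈ Finset.range M, (if bit e i₀ j₀ t then 1 else 0) / (2 : ℝ) ^ (t + 1)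
      set v := wordEval (fun i => z i x) (w e)
      have e1 : 1 + (2 * q - 1) * m e x - 1 - coef e x₀ * v =
          -(2 * (((coef e x₀ + 1) / 2 - q) * m e x)) + coef e x₀ * (m e x - v) := by ring
      have e2 : |((coef e x₀ + 1) / 2 - q) * m e x| ≤ 1 / 2 ^ M := by
        rw [abs_mul, abs_of_nonneg (m0 e x)]
        exact (mul_le_of_le_one_right (abs_nonneg _) (m1 e x)).trans hb
      have e3 : |coef e x₀ * (m e x - v)| ≤ 3 * Λ * (1 / 2 ^ M) := by
        rw [abs_mul]
        refine (mul_le_of_le_one_left (abs_nonneg _) (hcoef e x₀ hx₀m)).trans ((em e x).trans ?_)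
        have f1 : ((w e).length : ℝ) ≤ Λ := by exact_mod_cast hw e
        have f2 : (3 : ℝ) / 4 ^ M ≤ 3 * (1 / 2 ^ M) := by
          rw [mul_one_div]
          gcongr
          norm_num
        calc _ ≤ (Λ : ℝ) * (3 * (1 / 2 ^ M)) := by gcongr
          _ = _ := by ring
      rw [e1]
      refine (abs_add_le _ _).trans ?_
      rw [abs_neg, abs_mul, abs_two]
      calc _ ≤ 2 * (1 / 2 ^ M : ℝ) + 3 * Λ * (1 / 2 ^ M) := by gcongr
        _ = (2 + 3 * Λ) * (1 / 2 ^ M) := by ring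
        _ ≤ _ := by gcongr
    have t3 : |∑ e, (g e x - 1 - coef e x₀ * wordEval (fun i => z i x) (w e))| ≤
        Fintype.card ι * ((2 + 3 * Λ) * (1 / (k * k)) ^ s) := by
      refine (Finset.abs_sum_le_sum_abs _ _).trans ((Finset.sum_le_sum fun e _ => t2 e).trans ?_)
      simp
    rw [Finset.sum_sub_distrib, Finset.sum_sub_distrib] at t3
    simp only [Finset.sum_const, Finset.card_univ, nsmul_eq_mul, mul_one] at t3
    rw [abs_le] at t1 t3 ⊢
    constructor <;> linarith [t1.1, t1.2, t3.1, t3.2]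

/-! ### Removing the gaps by medians. -/

/-- Two of three values at distance `δ` avoid the gaps. -/
theorem AvoidsGaps.of_shift {k : ℕ} {δ u v : ℝ} (hδ : 0 < δ) (hk : 3 * δ ≤ 1 / (k * k))
    (h1 : u + δ ≤ v) (h2 : v ≤ u + 2 * δ) : AvoidsGaps k δ u ∨ AvoidsGaps k δ v := by
  by_contra hcon
  simp only [AvoidsGaps, not_or, not_forall, not_le] at hcon
  obtain ⟨⟨j, _, _, a1, a2⟩, ⟨j', _, _, b1, b2⟩⟩ := hcon
  set r : ℝ := 1 / (k * k)
  have hr : 0 < r := by linarith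
  -- Points in one gap are less than `δ` apart; points in different gaps are more than `1 / (k * k)
  -- - δ ≥ 2 * δ` apart.
  rcases lt_trichotomy j j' with h | rfl | h
  · have : (j : ℝ) + 1 ≤ j' := by exact_mod_cast h
    nlinarith
  · linarith
  · have : (j' : ℝ) + 1 ≤ j := by exact_mod_cast h
    nlinarith

/-- Shifted arguments may leave `[0,1]`; truncation then moves them to `0` or `1`, and neither
endpoint lies in a gap. -/
theorem AvoidsGaps.clamp01 {k : ℕ} {δ u : ℝ} (hδ : 3 * δ ≤ 1 / (k * k)) (h : AvoidsGaps k δ u) :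
    AvoidsGaps k δ (clamp01 u) := by
  intro j h1 h2
  have hk : 0 < k * k := by omega
  have hk' : (0 : ℝ) < k * k := by exact_mod_cast hk
  have hr : 0 < (1 : ℝ) / (k * k) := by positivity
  have hj : (1 : ℝ) ≤ j := by exact_mod_cast h1
  rcases le_total u 0 with h0 | h0
  · left
    rw [clamp01_of_nonpos h0]
    nlinarith
  rcases le_total 1 u with h3 | h3
  · right
    rw [clamp01_of_one_le h3, mul_one_div, div_le_one hk']
    exact_mod_cast h2.le
  · rw [clamp01_of_mem h0 h3]
    exact h j h1 h2

/-- `F` is approximated within `ε` wherever the coordinates from `p` on avoid the gaps. -/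
def ApproxOffGaps (d B T k : ℕ) (δ ε : ℝ) (F : (Fin d → ℝ) → ℝ) (p : ℕ) : Prop :=
  ∀ (X : Type) (y : Fin d → X → ℝ), (∀ i x, 0 ≤ y i x) → (∀ i x, y i x ≤ 1) →
    ∃ h : X → ℝ, (∀ x, 0 ≤ h x) ∧ Computes B T (List.ofFn y) [h] ∧
      ∀ x, (∀ i : Fin d, p ≤ i → AvoidsGaps k δ (y i x)) → |h x - F (fun i => y i x)| ≤ ε

/-- Run the approximation with coordinate `p` shifted by `-δ`, `0`, `δ`. At least two of the shifts
avoid the gaps, and a shift changes `F` by at most `η`, so the median is within `ε + η` with no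
condition on that coordinate. -/
theorem ApproxOffGaps.succ {d B T k p : ℕ} {δ ε η : ℝ} {F : (Fin d → ℝ) → ℝ}
    (H : ApproxOffGaps d B T k δ ε F p) (hp : p < d) (hδ : 0 < δ) (hk : 3 * δ ≤ 1 / (k * k))
    (hF : ∀ u ∈ unitCube d, ∀ v ∈ unitCube d, (∀ i, |u i - v i| ≤ δ) → |F u - F v| ≤ η) :
    ApproxOffGaps d (B + 3 * d + 10) (3 * T + 13) k δ (ε + η) F (p + 1) := by
  intro X y y0 y1
  have ny : AllNonneg (List.ofFn y) := .ofFn y0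
  set i₀ : Fin d := ⟨p, hp⟩ with hi₀
  have hη : 0 ≤ η := (abs_nonneg _).trans (hF 0 (mem_unitCube.2 (by simp)) 0
    (mem_unitCube.2 (by simp)) (by simp [hδ.le]))
  have key : ∀ t : ℝ, |t| ≤ δ → ∃ h : X → ℝ, (∀ x, 0 ≤ h x) ∧
      Computes (B + 2 * d + 3) (T + 3) (List.ofFn y) [h] ∧
      ∀ x, (∀ i : Fin d, p + 1 ≤ i → AvoidsGaps k δ (y i x)) → AvoidsGaps k δ (y i₀ x + t) →
        |h x - F (fun i => y i x)| ≤ ε + η := by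
    intro t ht
    set y' : Fin d → X → ℝ := Function.update y i₀ (fun x => clamp01 (y i₀ x + t)) with hy'
    have hself : ∀ x, y' i₀ x = clamp01 (y i₀ x + t) := fun x => by simp [hy']
    have hne : ∀ i, i ≠ i₀ → ∀ x, y' i x = y i x := fun i hi x => by simp [hy', hi]
    have y'0 : ∀ i x, 0 ≤ y' i x := fun i x => by
      rcases eq_or_ne i i₀ with rfl | hi
      · rw [hself]; exact clamp01_nonneg _
      · rw [hne i hi]; exact y0 i x
    have y'1 : ∀ i x, y' i x ≤ 1 := fun i x => by
      rcases eq_or_ne i i₀ with rfl | hi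
      · rw [hself]; exact clamp01_le_one _
      · rw [hne i hi]; exact y1 i x
    obtain ⟨h, h0, ch, eh⟩ := H X y' y'0 y'1
    refine ⟨h, h0, ?_, fun x hgap hgap' => ?_⟩
    · rw [add_comm T 3]
      refine Computes.call (h := fun x => clamp01 (y i₀ x + t)) (Computes.clamp ny
        (.add (.mem (List.mem_ofFn.2 ⟨i₀, rfl⟩)) (.const t))) ny (by simp) (by simp; omega) ?_
      refine (ch.mono (by omega) le_rfl).of_subset fun f hf => ?_
      obtain ⟨i, rfl⟩ := List.mem_ofFn.1 hf
      rcases eq_or_ne i i₀ with rfl | hi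
      · simp [hy']
      · simp [hy', hi]
    · have e1 := eh x fun i hi => by
        rcases eq_or_ne i i₀ with rfl | hne'
        · rw [hself]; exact hgap'.clamp01 hk
        · rw [hne i hne']
          refine hgap i ?_
          have : (i : ℕ) ≠ p := fun h => hne' (Fin.ext h)
          omega
      have e2 := hF (fun i => y' i x) (mem_unitCube.2 fun i => ⟨y'0 i x, y'1 i x⟩)
        (fun i => y i x) (mem_unitCube.2 fun i => ⟨y0 i x, y1 i x⟩) fun i => by
          rcases eq_or_ne i i₀ with rfl | hi
          · rw [hself]
            refine (abs_clamp01_sub_le (y0 _ x) (y1 _ x)).trans ?_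
            simpa using ht
          · rw [hne i hi]
            simpa using hδ.le
      have := abs_add_le (h x - F (fun i => y' i x)) (F (fun i => y' i x) - F (fun i => y i x))
      rw [sub_add_sub_cancel] at this
      linarith
  obtain ⟨h1, p1, c1, e1⟩ := key (-δ) (by rw [abs_neg, abs_of_pos hδ])
  obtain ⟨h2, p2, c2, e2⟩ := key 0 (by simp [hδ.le])
  obtain ⟨h3, p3, c3, e3⟩ := key δ (by rw [abs_of_pos hδ])
  refine ⟨fun x => median3 (h1 x) (h2 x) (h3 x), fun x => ?_, ?_, fun x hgap => ?_⟩
  · exact le_max_of_le_left (le_min (p1 x) (p2 x))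
  · have : Computes (B + 3 * d + 10) ((T + 3) + ((T + 3) + (T + 3 + 4))) (List.ofFn y)
        [fun x => median3 (h1 x) (h2 x) (h3 x)] := by
      refine Computes.call c1 ny (by simp) (by simp; omega) ?_
      refine Computes.call c2 (ny.cons p1) (by simp) (by simp; omega) ?_
      refine Computes.call c3 ((ny.cons p1).cons p2) ?_ (by simp; omega) ?_
      · intro f hf; simp [hf]
      · exact ((Computes.median p1 p2 p3).mono (by omega) le_rfl).of_subset (by simp)
    exact this.mono le_rfl (by omega)
  · apply abs_median3_sub_le
    have q1 := e1 x hgap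
    have q2 := e2 x hgap
    have q3 := e3 x hgap
    have r12 := AvoidsGaps.of_shift (k := k) (u := y i₀ x + -δ) (v := y i₀ x + 0) hδ hk (by linarith)
      (by linarith)
    have r13 := AvoidsGaps.of_shift (k := k) (u := y i₀ x + -δ) (v := y i₀ x + δ) hδ hk (by linarith)
      (by linarith)
    have r23 := AvoidsGaps.of_shift (k := k) (u := y i₀ x + 0) (v := y i₀ x + δ) hδ hk (by linarith)
      (by linarith)
    tauto

theorem ApproxOffGaps.all {d B T k : ℕ} {δ ε η : ℝ} {F : (Fin d → ℝ) → ℝ}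
    (H : ApproxOffGaps d B T k δ ε F 0) (hδ : 0 < δ) (hk : 3 * δ ≤ 1 / (k * k))
    (hF : ∀ u ∈ unitCube d, ∀ v ∈ unitCube d, (∀ i, |u i - v i| ≤ δ) → |F u - F v| ≤ η) :
    ∀ p ≤ d, ApproxOffGaps d (B + p * (3 * d + 10)) (16 ^ p * (T + 1)) k δ (ε + p * η) F p := by
  intro p
  induction p with
  | zero =>
    intro _ X y y0 y1
    obtain ⟨h, h0, ch, eh⟩ := H X y y0 y1
    exact ⟨h, h0, ch.mono (by simp) (by simp), fun x hx => by simpa using eh x hx⟩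
  | succ p ih =>
    intro hp X y y0 y1
    obtain ⟨h, h0, ch, eh⟩ := (ih (by omega)).succ (by omega) hδ hk hF X y y0 y1
    refine ⟨h, h0, ch.mono (by linarith) ?_, fun x hx => (eh x hx).trans (by push_cast; linarith)⟩
    -- The base `16` is `3 + 13`: for `t ≥ 1` the new depth `3 * t + 13` is at most `16 * t`.
    have : 1 ≤ 16 ^ p * (T + 1) := Nat.one_le_iff_ne_zero.2 (by positivity)
    rw [pow_succ]
    nlinarith

/-! ### Choice of the grid and parameter count. -/

/-- The size parameter of the construction in terms of the number of network parameters. -/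
theorem exists_size (c d s : ℕ) (hc : 0 < c) (hd : 0 < d) : ∃ C : ℝ, 0 < C ∧ ∃ W₀ : ℕ, ∀ W : ℕ,
    W₀ ≤ W → ∃ k : ℕ, 1 ≤ k ∧ c * (k ^ d * (Nat.log 2 k + 1)) ≤ W ∧
      (1 / (k * k) : ℝ) ^ s ≤
        C * ((W : ℝ) / Real.log (W : ℝ)) ^ (-(2 * (s : ℝ) / (d : ℝ))) := by
  -- The `3` covers `Nat.log 2 k + 1 ≤ 2 * log W + 1 ≤ 3 * log W`, valid for `k ≤ W` and `log W ≥
  -- 1`.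
  set c' : ℝ := 3 * c with hc'
  have hc1 : (1 : ℝ) ≤ c := by exact_mod_cast hc
  have c'0 : 0 < c' := by positivity
  have hd' : (0 : ℝ) < d := by exact_mod_cast hd
  have hlim : ∀ᶠ W : ℕ in Filter.atTop, c' * Real.log W ≤ W := by
    have h1 := (Real.isLittleO_log_id_atTop.bound (show 0 < 1 / c' by positivity))
    have h2 := tendsto_natCast_atTop_atTop (R := ℝ) |>.eventually h1
    filter_upwards [h2] with W hW
    simp only [id, Real.norm_eq_abs, Nat.abs_cast] at hW
    have h3 := (le_abs_self _).trans hW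
    rw [one_div, inv_mul_eq_div, le_div_iff₀ c'0] at h3
    linarith
  obtain ⟨W₁, hW₁⟩ := Filter.eventually_atTop.1 hlim
  refine ⟨2 ^ (2 * s) * c' ^ (2 * (s : ℝ) / d), by positivity, max 3 W₁, fun W hW => ?_⟩
  have hW3 : (3 : ℝ) ≤ W := by exact_mod_cast (le_max_left _ _).trans hW
  have hlogW : 1 ≤ Real.log W := by
    rw [Real.le_log_iff_exp_le (by linarith)]
    linarith [Real.exp_one_lt_d9]
  have hR := hW₁ W ((le_max_right _ _).trans hW)
  set R : ℝ := W / (c' * Real.log W) with hRdef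
  have hden : 0 < c' * Real.log W := by positivity
  have hR1 : 1 ≤ R := (one_le_div hden).2 hR
  have hRd : 1 ≤ R ^ (1 / d : ℝ) := Real.one_le_rpow hR1 (by positivity)
  set k := ⌊R ^ (1 / d : ℝ)⌋₊ with hk
  have hk1 : 1 ≤ k := Nat.le_floor (by simpa using hRd)
  have hk1' : (1 : ℝ) ≤ k := by exact_mod_cast hk1
  have hkle : (k : ℝ) ≤ R ^ (1 / d : ℝ) := Nat.floor_le (by linarith)
  -- Rounding down loses at most a factor `2`, the source of `2 ^ (2 * s)` in the constant.
  have hkge : R ^ (1 / d : ℝ) ≤ 2 * k := by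
    have := (Nat.lt_floor_add_one (R ^ (1 / d : ℝ))).le
    linarith
  have hkd : (k : ℝ) ^ d ≤ R := by
    calc (k : ℝ) ^ d ≤ (R ^ (1 / d : ℝ)) ^ d := pow_le_pow_left₀ (by positivity) hkle _
      _ = R := by rw [← Real.rpow_natCast, ← Real.rpow_mul (by linarith), one_div_mul_cancel hd'.ne',
          Real.rpow_one]
  refine ⟨k, hk1, ?_, ?_⟩
  · have hkW : (k : ℝ) ≤ W := by
      calc (k : ℝ) ≤ (k : ℝ) ^ d := le_self_pow₀ hk1' hd.ne'
        _ ≤ R := hkd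
        _ ≤ W := div_le_self (by linarith) (by nlinarith)
    have hlog : (Nat.log 2 k : ℝ) ≤ 2 * Real.log W := by
      have h1 := Real.natLog_le_logb k 2
      have h2 : Real.log k ≤ Real.log W := Real.log_le_log (by linarith) hkW
      rw [Real.logb] at h1
      push_cast at h1
      refine h1.trans ?_
      rw [div_le_iff₀ (Real.log_pos (by norm_num))]
      nlinarith [Real.log_two_gt_d9]
    have : (c : ℝ) * ((k : ℝ) ^ d * (Nat.log 2 k + 1)) ≤ W := by
      calc (c : ℝ) * ((k : ℝ) ^ d * (Nat.log 2 k + 1)) ≤ c * (R * (3 * Real.log W)) := by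
            gcongr
            linarith
        _ = W := by
            rw [hRdef, hc']
            field_simp
    exact_mod_cast this
  · have hRp : 0 < R := by linarith
    have h1 : (1 / (k * k) : ℝ) ^ s = 2 ^ (2 * s) * (2 * k : ℝ) ^ (-(2 * (s : ℝ))) := by
      rw [Real.rpow_neg (by positivity), show (2 * (s : ℝ)) = ((2 * s : ℕ) : ℝ) by push_cast; ring,
        Real.rpow_natCast, mul_pow, ← pow_two, one_div_pow, ← pow_mul]
      field_simp
    have h2 : (2 * k : ℝ) ^ (-(2 * (s : ℝ))) ≤ (R ^ (1 / d : ℝ)) ^ (-(2 * (s : ℝ))) :=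
      Real.rpow_le_rpow_of_nonpos (by linarith) hkge (by linarith [Nat.cast_nonneg (α := ℝ) s])
    have h3 : (R ^ (1 / d : ℝ)) ^ (-(2 * (s : ℝ))) = c' ^ (2 * (s : ℝ) / d) *
        ((W : ℝ) / Real.log (W : ℝ)) ^ (-(2 * (s : ℝ) / (d : ℝ))) := by
      rw [← Real.rpow_mul hRp.le, show R = (W / Real.log W) * c'⁻¹ by rw [hRdef]; field_simp,
        Real.mul_rpow (by positivity) (by positivity),
        show 1 / (d : ℝ) * -(2 * (s : ℝ)) = -(2 * (s : ℝ) / d) by ring,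
        Real.inv_rpow c'0.le, Real.rpow_neg c'0.le, inv_inv]
      ring
    rw [h1, mul_assoc, ← h3]
    gcongr

theorem mainTheorem3 (d s : ℕ) (hd : 0 < d) (hs : 0 < s) :
    ∃ C : ℝ, 0 < C ∧ ∃ W₀ : ℕ, ∀ W : ℕ, W₀ ≤ W →
      ∀ f ∈ CsUnitBall d s, ∃ φ ∈ NNParam d W,
        cubeLInftyNorm (fun x => φ x - f x) ≤
          ENNReal.ofReal (C * ((W : ℝ) / Real.log (W : ℝ)) ^ (-(2 * (s : ℝ) / (d : ℝ)))) := by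
  obtain ⟨B, c, C, N, hB1, hBd, hC, H⟩ := exists_computes_approx d s hd
  set B' := B + d * (3 * d + 10) with hB'
  obtain ⟨C', hC', W₀, HW⟩ := exists_size ((16 ^ d * (c + 1) + 1) * (B' * B' + B') + 9) d s
    (by positivity) hd
  refine ⟨(C + 1) * C', by positivity, W₀, fun W hW f hf => ?_⟩
  obtain ⟨k, hk, hkW, hkC⟩ := HW W hW
  have k0 : (0 : ℝ) < k := by exact_mod_cast hk
  have hd' : (0 : ℝ) < d := by exact_mod_cast hd
  set ε : ℝ := (1 / (k * k)) ^ s with hε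
  have ε0 : 0 < ε := by positivity
  have huc : UniformContinuousOn f (unitCube d) :=
    isCompact_Icc.uniformContinuousOn_of_continuous hf.1.continuousOn
  -- The tolerance `ε / d` makes the `d` median steps cost `ε` together.
  obtain ⟨δ', hδ', hfδ⟩ := Metric.uniformContinuousOn_iff.1 huc (ε / d) (by positivity)
  set δ : ℝ := min (δ' / 2) (1 / 3 * (1 / (k * k))) with hδ
  have δ0 : 0 < δ := by positivity
  have hδk : 3 * δ ≤ 1 / (k * k) := by
    have := min_le_right (δ' / 2) (1 / 3 * (1 / (k * k) : ℝ))
    linarith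
  have hF : ∀ u ∈ unitCube d, ∀ v ∈ unitCube d, (∀ i, |u i - v i| ≤ δ) →
      |(f u + N) - (f v + N)| ≤ ε / d := by
    intro u hu v hv huv
    rw [add_sub_add_right_eq_sub]
    refine (hfδ u hu v hv ?_).le
    have h1 : dist u v ≤ δ := (dist_pi_le_iff δ0.le).2 huv
    have h2 := min_le_left (δ' / 2) (1 / 3 * (1 / (k * k) : ℝ))
    linarith
  set Q := k ^ d * (Nat.log 2 k + 1) with hQ
  have hQ1 : 1 ≤ Q := Nat.one_le_iff_ne_zero.2 (by positivity)
  have hoff : ApproxOffGaps d B (c * Q) k δ (C * ε) (fun x => f x + N) 0 := by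
    intro X y y0 y1
    obtain ⟨h, h0, ch, eh⟩ := H k hk f hf δ δ0 X y y0 y1
    exact ⟨h, h0, ch, fun x hx => eh x fun i => hx i (Nat.zero_le _)⟩
  -- With `p = d` no gap condition is left. Taking the cube itself as the domain `X` makes the input
  -- coordinates nonnegative and at most one.
  obtain ⟨h, h0, ch, eh⟩ := hoff.all δ0 hδk hF d le_rfl (unitCube d) (fun i x => x.1 i)
    (fun i x => (mem_unitCube.1 x.2 i).1) (fun i x => (mem_unitCube.1 x.2 i).2)
  have hWT : (16 ^ d * (c * Q + 1) + 1) * (B' * B' + B') + 9 ≤ W := by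
    refine le_trans ?_ hkW
    calc (16 ^ d * (c * Q + 1) + 1) * (B' * B' + B') + 9
        ≤ (16 ^ d * (c * Q + 1 * Q) + 1 * Q) * (B' * B' + B') + 9 * Q := by
          gcongr <;> omega
      _ = _ := by ring
  obtain ⟨ws, w1, w2, w3, net, hnet⟩ := ch.exists_net (by omega) N (n := d) (by omega)
    (fun i x => x.1 i) (fun g hg => List.mem_ofFn.1 hg) h0 W hWT
  refine ⟨fun x => net.eval x 0, ⟨ws, w1, w2, w3, net, fun _ => rfl⟩, ?_⟩
  rw [cubeLInftyNorm, eLpNorm_exponent_top]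
  refine eLpNormEssSup_le_of_ae_bound (ae_restrict_of_forall_mem measurableSet_Icc fun x hx => ?_)
  have e1 := eh ⟨x, hx⟩ fun i hi => absurd i.2 (by omega)
  have e2 := hnet ⟨x, hx⟩
  simp only at e1 e2
  change ‖net.eval (fun i => x i) 0 - f x‖ ≤ _
  rw [Real.norm_eq_abs, e2, show h ⟨x, hx⟩ - N - f x = h ⟨x, hx⟩ - (f x + N) by ring]
  refine e1.trans ?_
  rw [mul_div_cancel₀ _ hd'.ne', mul_assoc]
  calc C * ε + ε = (C + 1) * ε := by ring
    _ ≤ _ := by gcongr
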